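/- Let $f_0,\rho_0\in C^\infty([0,1])$ satisfy $f_0(0)=f_0(1)=0$, $\rho_0(0)=\rho_0(1)=0$ and $\rho_0\ge 0$ on $[0,1]$. Suppose that $M_0:=\max_{[0,1]}f_0'>0$, that $f_0'$ attains the value $M_0$ only at boundary points $x_i^*\in\{0,1\}$, and that $f_0''(x_i^*)\neq 0$ at each such point (derivatives at $0$ and $1$ are one-sided). Consider the initial-boundary value problem $$f_{xt}+ff_{xx}-f_x^2+\rho=I(t),\qquad \rho_t+f\rho_x=\rho f_x,\qquad I(t)=\int_0^1\rho\,dx-2\int_0^1 f_x^2\,dx,$$ for $x\in[0,1]$, $t>0$, with $f(0,x)=f_0(x)$, $\rho(0,x)=\rho_0(x)$ and Dirichlet conditions $f(t,0)=f(t,1)=0$, $\rho(t,0)=\rho(t,1)=0$. A classical solution on $[0,T)$ is a pair $(f,\rho)$ for which $f,f_x,f_{xx},\rho,\rho_x$ exist and are continuous on $[0,T)\times[0,1]$, $f_{xt}$ and $\rho_t$ exist for $0<t<T$, and the equations, initial conditions and boundary conditions hold pointwise. Then there are a finite time $t^*>0$ and a classical solution $(f,\rho)$ on $[0,t^*)$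 such that every classical solution with the same data on an interval $[0,T)$ satisfies $T\le t^*$ and coincides with $(f,\rho)$ on $[0,T)\times[0,1]$, and such that, at each point $x_i^*$ where $f_0'$ attains $M_0$, $$\lim_{t\nearrow t^*}\int_0^t f_x(s,x_i^*)\,ds=+\infty,$$ and the vorticity $-y f_{xx}(t,x)$ of the velocity field $u=(f,-yf_x)$ on $[0,1]\times(0,\infty)$ blows up at $x_i^*$ at time $t^*$: for every $y>0$, $$\lim_{t\nearrow t^*}\left|-y f_{xx}(t,x_i^*)\right|=+\infty.$$ If moreover $f_0'$ attains $M_0$ at both endpoints, the blowup is two-sided: $$\lim_{t\nearrow t^*}f_{xx}(t,0)=-\infty,\qquad \lim_{t\nearrow t^*}f_{xx}(t,1)=+\infty .$$ -/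

import Mathlib

open Set Filter Topology

noncomputable section

namespace Boussinesq

/-- Spatial derivative on the closed interval `[0,1]` (one-sided at the two endpoints). -/
def dx (g : ℝ → ℝ) : ℝ → ℝ := fun x => derivWithin g (Icc 0 1) x

/-- The nonlocal term `I(t) = ∫₀¹ ρ dx - 2 ∫₀¹ f_x² dx`. -/
def nonlocalTerm (f ρ : ℝ → ℝ → ℝ) (t : ℝ) : ℝ :=
  (∫ x in (0 : ℝ)..1, ρ t x) - 2 * ∫ x in (0 : ℝ)..1, (dx (f t) x) ^ 2

/-- The vorticity `∇ × u = -y f_xx(t,x)` of the stagnation-point velocity field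
`u = (f(t,x), -y f_x(t,x))`. -/
def vorticity (f : ℝ → ℝ → ℝ) (t x y : ℝ) : ℝ := -y * dx (dx (f t)) x

/-- `(f, ρ)` is a classical solution on `[0,T) × [0,1]` of
`f_xt + f f_xx - f_x² + ρ = I(t)`, `ρ_t + f ρ_x = ρ f_x`
with initial data `(f₀, ρ₀)` and Dirichlet boundary conditions.
The functions `f, f_x, f_xx, ρ, ρ_x` are continuous on `[0,T) × [0,1]`, the time derivatives
`f_xt, ρ_t` exist for `0 < t < T` (their continuity follows from the equations), and the
equations hold pointwise. Values of `f t x`, `ρ t x` off `[0,T) × [0,1]` play no role. -/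
structure IsClassicalSolution (f₀ ρ₀ : ℝ → ℝ) (T : ℝ) (f ρ : ℝ → ℝ → ℝ) : Prop where
  contDiff_f : ∀ t ∈ Ico 0 T, ContDiffOn ℝ 2 (f t) (Icc 0 1)
  contDiff_rho : ∀ t ∈ Ico 0 T, ContDiffOn ℝ 1 (ρ t) (Icc 0 1)
  continuous_f : ContinuousOn (fun p : ℝ × ℝ => f p.1 p.2) (Ico 0 T ×ˢ Icc 0 1)
  continuous_fx : ContinuousOn (fun p : ℝ × ℝ => dx (f p.1) p.2) (Ico 0 T ×ˢ Icc 0 1)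
  continuous_fxx : ContinuousOn (fun p : ℝ × ℝ => dx (dx (f p.1)) p.2) (Ico 0 T ×ˢ Icc 0 1)
  continuous_rho : ContinuousOn (fun p : ℝ × ℝ => ρ p.1 p.2) (Ico 0 T ×ˢ Icc 0 1)
  continuous_rhox : ContinuousOn (fun p : ℝ × ℝ => dx (ρ p.1) p.2) (Ico 0 T ×ˢ Icc 0 1)
  differentiable_fx : ∀ t ∈ Ioo 0 T, ∀ x ∈ Icc (0 : ℝ) 1,
    DifferentiableAt ℝ (fun s => dx (f s) x) t
  differentiable_rho : ∀ t ∈ Ioo 0 T, ∀ x ∈ Icc (0 : ℝ) 1,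
    DifferentiableAt ℝ (fun s => ρ s x) t
  momentum : ∀ t ∈ Ioo 0 T, ∀ x ∈ Icc (0 : ℝ) 1,
    deriv (fun s => dx (f s) x) t + f t x * dx (dx (f t)) x - (dx (f t) x) ^ 2 + ρ t x
      = nonlocalTerm f ρ t
  temperature : ∀ t ∈ Ioo 0 T, ∀ x ∈ Icc (0 : ℝ) 1,
    deriv (fun s => ρ s x) t + f t x * dx (ρ t) x = ρ t x * dx (f t) x
  initial_f : ∀ x ∈ Icc (0 : ℝ) 1, f 0 x = f₀ x
  initial_rho : ∀ x ∈ Icc (0 : ℝ) 1, ρ 0 x = ρ₀ x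
  boundary_f : ∀ t ∈ Ico 0 T, f t 0 = 0 ∧ f t 1 = 0
  boundary_rho : ∀ t ∈ Ico 0 T, ρ t 0 = 0 ∧ ρ t 1 = 0

end Boussinesq

end

/-!
Let `w` be the reciprocal Jacobian of the particle flow of `f`. Along trajectories the system
becomes the linear equation `w_tt + c(t) w = ρ₀`, with `w = 1` and `w_t = -f₀'` at `t = 0`, where
`c` is fixed by the constraint `∫₀¹ w⁻¹ = 1`. It is solved in a stretched time `η` by
`w = K (1 - η f₀' + g(η) ρ₀)` with `K(η) = ∫₀¹ (1 - η f₀' + g(η) ρ₀)⁻¹`, `dη/dt = K⁻²`, and the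
amplitude `g` given by the scalar equation `g'' = K³`, `g(0) = g'(0) = 0`. The amplitude stays
nonnegative, so the bracket remains positive up to `η = 1/M₀`.

Nondegeneracy of the boundary maxima gives `M₀ - f₀' ≥ κ x (1 - x)` with `κ > 0`, whence
`K ≤ C (1 - M₀ η)^(-1/4)`. Therefore `t = ∫ K² dη` tends to a finite time `t*` as `η → 1/M₀`, while
`w = K (1 - M₀ η) → 0` at the maximum points. There `∫₀ᵗ f_x = -log w → ∞`, and `w f_xx` is the sum
of `f₀''` and a term of the same sign coming from `ρ₀'`, so that `f_xx` blows up. An energy estimate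
gives uniqueness, and a longer solution would keep `∫₀ᵗ f_x` bounded, so `t*` is the lifespan.
-/

noncomputable section

namespace Boussinesq

open Function MeasureTheory
open scoped NNReal

section ParametricIntegral

variable {X E : Type*} [TopologicalSpace X] [NormedAddCommGroup E] [NormedSpace ℝ E]

theorem continuous_slice {Y Z : Type*} [TopologicalSpace Y] [TopologicalSpace Z] {S : Set X}
    {F : X → Y → Z} (hF : ContinuousOn (uncurry F) (S ×ˢ univ)) {t : X} (ht : t ∈ S) :
    Continuous (F t) :=
  hF.comp_continuous (f := fun a => (t, a)) (by fun_prop) fun _ => ⟨ht, mem_univ _⟩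

theorem continuousOn_slice {Y Z : Type*} [TopologicalSpace Y] [TopologicalSpace Z] {S : Set X}
    {U : Set Y} {F : X → Y → Z} (hF : ContinuousOn (uncurry F) (S ×ˢ U)) {t : X} (ht : t ∈ S) :
    ContinuousOn (F t) U :=
  hF.comp (f := fun a => (t, a)) (by fun_prop) fun _ ha => ⟨ht, ha⟩

theorem continuousOn_parametric_primitive {S : Set X} {F : X → ℝ → E}
    (hF : ContinuousOn (uncurry F) (S ×ˢ univ)) (c : ℝ) :
    ContinuousOn (fun p : X × ℝ => ∫ a in c..p.2, F p.1 a) (S ×ˢ univ) := by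
  have hF_restrict : Continuous (uncurry fun (p : S × ℝ) (a : ℝ) => F p.1 a) :=
    hF.comp_continuous (f := fun q : (S × ℝ) × ℝ => ((q.1.1 : X), q.2)) (by fun_prop)
      fun q => ⟨q.1.1.2, mem_univ _⟩
  have primitive := intervalIntegral.continuous_parametric_intervalIntegral_of_continuous
    (μ := volume) (a₀ := c) hF_restrict (s := fun p : S × ℝ => p.2) (by fun_prop)
  rw [continuousOn_iff_continuous_domRestrict]
  exact primitive.comp (g := fun p : S × ℝ => ∫ a in c..p.2, F p.1 a)
    (f := fun q : (S ×ˢ univ : Set (X × ℝ)) => ((⟨q.1.1, q.2.1⟩ : S), q.1.2)) (by fun_prop)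

theorem continuousOn_parametric_integral {S : Set X} {F : X → ℝ → E} {c d : ℝ} (hcd : c ≤ d)
    (hF : ContinuousOn (uncurry F) (S ×ˢ Icc c d)) :
    ContinuousOn (fun t => ∫ a in c..d, F t a) S := by
  have hF_proj : ContinuousOn (uncurry fun t a => F t (projIcc c d hcd a)) (S ×ˢ univ) :=
    hF.comp (f := fun q : X × ℝ => (q.1, (projIcc c d hcd q.2 : ℝ)))
      (by fun_prop : Continuous _).continuousOn fun q hq => ⟨hq.1, Subtype.coe_prop _⟩
  have integral_proj := (continuousOn_parametric_primitive hF_proj c).comp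
    (f := fun t : X => (t, d)) (s := S) (by fun_prop) fun t ht => ⟨ht, mem_univ _⟩
  refine integral_proj.congr fun t _ => intervalIntegral.integral_congr fun a ha => ?_
  rw [uIcc_of_le hcd] at ha
  simp only [projIcc_of_mem hcd ha]

theorem hasDerivAt_parametric_integral {S : Set ℝ} (hS : IsOpen S) {F F' : ℝ → ℝ → E}
    {c d : ℝ} (hcd : c ≤ d) (hF : ∀ t ∈ S, ContinuousOn (F t) (Icc c d))
    (hF' : ContinuousOn (uncurry F') (S ×ˢ Icc c d))
    (hd : ∀ t ∈ S, ∀ a ∈ Icc c d, HasDerivAt (fun s => F s a) (F' t a) t) {t : ℝ} (ht : t ∈ S) :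
    HasDerivAt (fun s => ∫ a in c..d, F s a) (∫ a in c..d, F' t a) t := by
  obtain ⟨ε, hε, hball⟩ := Metric.nhds_basis_closedBall.mem_iff.1 (hS.mem_nhds ht)
  obtain ⟨B, hB⟩ := ((isCompact_closedBall t ε).prod isCompact_Icc).exists_bound_of_continuousOn
    (hF'.mono (prod_mono hball le_rfl))
  have hsub : uIoc c d ⊆ Icc c d := (uIoc_of_le hcd).trans_subset Ioc_subset_Icc_self
  refine (intervalIntegral.hasDerivAt_integral_of_dominated_loc_of_deriv_le (F := F) (F' := F')
    (bound := fun _ => B) (Metric.closedBall_mem_nhds t hε) ?_ ?_ ?_ ?_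
    intervalIntegrable_const ?_).2
  · filter_upwards [hS.mem_nhds ht] with s hs
    exact ((hF s hs).mono hsub).aestronglyMeasurable measurableSet_uIoc
  · exact (hF t ht).intervalIntegrable_of_Icc hcd
  · exact ((continuousOn_slice hF' ht).mono hsub).aestronglyMeasurable measurableSet_uIoc
  · exact Eventually.of_forall fun a ha s hs => hB (s, a) ⟨hs, hsub ha⟩
  · exact Eventually.of_forall fun a ha s hs => hd s (hball hs) a (hsub ha)

theorem hasFDerivAt_parametric_primitive [CompleteSpace E] {S : Set ℝ} (hS : IsOpen S)
    {F F' : ℝ → ℝ → E} (hF : ContinuousOn (uncurry F) (S ×ˢ univ))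
    (hF' : ContinuousOn (uncurry F') (S ×ˢ univ))
    (hd : ∀ t ∈ S, ∀ a, HasDerivAt (fun s => F s a) (F' t a) t) {t x c : ℝ} (ht : t ∈ S) :
    HasFDerivAt (fun p : ℝ × ℝ => ∫ a in c..p.2, F p.1 a)
      ((ContinuousLinearMap.toSpanSingleton ℝ (∫ a in c..x, F' t a)).coprod
        (ContinuousLinearMap.toSpanSingleton ℝ (F t x))) (t, x) := by
  have hSn : S ×ˢ (univ : Set ℝ) ∈ 𝓝 (t, x) := (hS.prod isOpen_univ).mem_nhds ⟨ht, mem_univ _⟩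
  have deriv_of_le : ∀ s ∈ S, ∀ {y z : ℝ}, y ≤ z →
      HasDerivAt (fun s => ∫ a in y..z, F s a) (∫ a in y..z, F' s a) s := fun s hs y z hyz =>
    hasDerivAt_parametric_integral hS hyz (fun τ hτ => (continuous_slice hF hτ).continuousOn)
      (hF'.mono (prod_mono le_rfl (subset_univ _))) (fun τ hτ a _ => hd τ hτ a) hs
  have toSpan_continuous :=
    (ContinuousLinearMap.toSpanSingletonCLE (𝕜 := ℝ) (E := E)).continuous
  refine (hasStrictFDerivAt_uncurry_coprod (𝕜 := ℝ) (u := (t, x))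
    (f := fun s y => ∫ a in c..y, F s a)
    (f₁ := fun s y => ContinuousLinearMap.toSpanSingleton ℝ (∫ a in c..y, F' s a))
    (f₂ := fun s y => ContinuousLinearMap.toSpanSingleton ℝ (F s y)) ?_ ?_ ?_ ?_).hasFDerivAt
  · filter_upwards [hSn] with p hp
    refine HasDerivAt.hasFDerivAt ?_
    rcases le_total c p.2 with h | h
    · exact deriv_of_le p.1 hp.1 h
    · simp only [intervalIntegral.integral_symm p.2 c]
      exact (deriv_of_le p.1 hp.1 h).neg
  · filter_upwards [hSn] with p hp
    exact ((continuous_slice hF hp.1).integral_hasStrictDerivAt c p.2).hasDerivAt.hasFDerivAt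
  · exact toSpan_continuous.continuousAt.comp
      ((continuousOn_parametric_primitive hF' c).continuousAt hSn)
  · exact toSpan_continuous.continuousAt.comp (hF.continuousAt hSn)

end ParametricIntegral

theorem continuousOn_parametric_inverse {X α β : Type*} [TopologicalSpace X]
    [TopologicalSpace α] [LinearOrder α] [OrderTopology α]
    [TopologicalSpace β] [LinearOrder β] [OrderClosedTopology β] {S : Set X} {U : Set β}
    {G : X → α → β} {Y : X → β → α} (hG : ∀ y, ContinuousOn (fun t => G t y) S)
    (hmono : ∀ t ∈ S, StrictMono (G t)) (hY : ∀ t ∈ S, ∀ x ∈ U, G t (Y t x) = x) :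
    ContinuousOn (uncurry Y) (S ×ˢ U) := by
  rintro ⟨t, x⟩ ⟨ht, hx⟩
  have hG_fst : ∀ y, ContinuousWithinAt (fun p : X × β => G p.1 y) (S ×ˢ U) (t, x) := fun y =>
    (hG y t ht).comp (f := Prod.fst) (x := (t, x)) continuousWithinAt_fst fun p hp => hp.1
  have hsnd : ContinuousWithinAt (fun p : X × β => p.2) (S ×ˢ U) (t, x) := continuousWithinAt_snd
  refine tendsto_order.2 ⟨fun y hy => ?_, fun y hy => ?_⟩
  · have hlt : G t y < x := (hmono t ht hy).trans_eq (hY t ht x hx)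
    filter_upwards [(hG_fst y).eventually_lt hsnd hlt, self_mem_nhdsWithin] with p hp hpS
    rw [← (hmono p.1 hpS.1).lt_iff_lt]
    exact hp.trans_eq (hY p.1 hpS.1 p.2 hpS.2).symm
  · have hlt : x < G t y := (hY t ht x hx).symm.trans_lt (hmono t ht hy)
    filter_upwards [hsnd.eventually_lt (hG_fst y) hlt, self_mem_nhdsWithin] with p hp hpS
    rw [← (hmono p.1 hpS.1).lt_iff_lt]
    exact (hY p.1 hpS.1 p.2 hpS.2).trans_lt hp

theorem hasDerivAt_parametric_inverse {G : ℝ × ℝ → ℝ} {Y : ℝ → ℝ} {t x g₁ g₂ : ℝ}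
    (hG : HasFDerivAt G ((ContinuousLinearMap.toSpanSingleton ℝ g₁).coprod
      (ContinuousLinearMap.toSpanSingleton ℝ g₂)) (t, Y t)) (hg₂ : g₂ ≠ 0)
    (hY : ContinuousAt Y t) (h : ∀ᶠ s in 𝓝 t, G (s, Y s) = x) :
    HasDerivAt Y (-g₁ / g₂) t := by
  have hinv : LeftInverse
      ((ContinuousLinearMap.fst ℝ ℝ ℝ).prod
        ((ContinuousLinearMap.toSpanSingleton ℝ (-g₁ / g₂)).coprod
          (ContinuousLinearMap.toSpanSingleton ℝ (1 / g₂))))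
      ((ContinuousLinearMap.fst ℝ ℝ ℝ).prod ((ContinuousLinearMap.toSpanSingleton ℝ g₁).coprod
        (ContinuousLinearMap.toSpanSingleton ℝ g₂))) := by
    rintro ⟨u, v⟩
    ext <;> simp
    field_simp
    ring
  have graph_deriv : HasFDerivAt (fun p : ℝ × ℝ => (p.1, G p)) _ (t, Y t) :=
    hasFDerivAt_fst.prodMk hG
  have level_deriv : HasFDerivAt (𝕜 := ℝ) (fun s : ℝ => (s, x)) _ t :=
    (hasFDerivAt_id t).prodMk (hasFDerivAt_const x t)
  have curve_deriv := HasFDerivAt.of_comp_of_leftInverse (g := fun s => (s, Y s))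
    (by exact continuousAt_id.prodMk hY) graph_deriv level_deriv
    (by filter_upwards [h] with s hs; simp [hs]) hinv
  convert! (hasFDerivAt_snd.comp t curve_deriv).hasDerivAt using 1
  simp

/-- The mean value inequality in time, at the moving position `Y s`, controls the increment by the
continuity of `F'`. -/
theorem hasDerivAt_sub_along_curve {F F' : ℝ → ℝ → ℝ} {Y : ℝ → ℝ} {U : Set ℝ} {t : ℝ}
    (hd : ∀ᶠ s in 𝓝 t, ∀ y ∈ U, HasDerivAt (fun s => F s y) (F' s y) s)
    (hF' : ContinuousWithinAt (uncurry F') (univ ×ˢ U) (t, Y t))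
    (hY : ContinuousAt Y t) (hU : ∀ᶠ s in 𝓝 t, Y s ∈ U) :
    HasDerivAt (fun s => F s (Y s) - F t (Y s)) (F' t (Y t)) t := by
  rw [hasDerivAt_iff_isLittleO, Asymptotics.isLittleO_iff]
  intro ε hε
  have hnear : ∀ᶠ p in 𝓝[univ ×ˢ U] (t, Y t), dist (F' p.1 p.2) (F' t (Y t)) < ε :=
    Metric.tendsto_nhds.1 hF' ε hε
  rw [nhdsWithin_prod_eq, nhdsWithin_univ] at hnear
  obtain ⟨nearTime, hTime, nearSpace, hSpace, hdist⟩ := Filter.eventually_prod_iff.1 hnear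
  have hYU : Tendsto Y (𝓝 t) (𝓝[U] (Y t)) := tendsto_nhdsWithin_iff.2 ⟨hY, hU⟩
  obtain ⟨δ, hδ, hball⟩ := Metric.eventually_nhds_iff_ball.1 (hTime.and hd)
  filter_upwards [hYU.eventually hSpace, hU, Metric.ball_mem_nhds t hδ] with s hs hsU hsδ
  have mean_value := (convex_ball t δ).norm_image_sub_le_of_norm_hasDerivWithin_le
    (f := fun σ => F σ (Y s) - σ * F' t (Y t))
    (f' := fun σ => F' σ (Y s) - 1 * F' t (Y t)) (C := ε)
    (fun σ hσ => (((hball σ hσ).2 (Y s) hsU).sub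
      ((hasDerivAt_id σ).mul_const _)).hasDerivWithinAt)
    (fun σ hσ => by simpa [Real.dist_eq] using (hdist (hball σ hσ).1 hs).le)
    (Metric.mem_ball_self hδ) hsδ
  convert! mean_value using 2
  simp only [smul_eq_mul]
  ring

theorem hasDerivAt_along_curve {F F' : ℝ → ℝ → ℝ} {Y : ℝ → ℝ} {U : Set ℝ} {t y' Fx : ℝ}
    (hd : ∀ᶠ s in 𝓝 t, ∀ y ∈ U, HasDerivAt (fun s => F s y) (F' s y) s)
    (hF' : ContinuousWithinAt (uncurry F') (univ ×ˢ U) (t, Y t))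
    (hx : HasDerivWithinAt (F t) Fx U (Y t)) (hY : HasDerivAt Y y' t)
    (hU : ∀ᶠ s in 𝓝 t, Y s ∈ U) :
    HasDerivAt (fun s => F s (Y s)) (F' t (Y t) + Fx * y') t := by
  have h := (hasDerivAt_sub_along_curve hd hF' hY.continuousAt hU).fun_add
    (hx.comp_hasDerivAt t hY hU)
  simpa only [comp_apply, sub_add_cancel] using h

section UnitInterval

variable {q q' q'' : ℝ → ℝ} {x : ℝ}

theorem contDiffOn_one_of_hasDerivWithinAt
    (h : ∀ x ∈ Icc (0 : ℝ) 1, HasDerivWithinAt q (q' x) (Icc 0 1) x)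
    (hc : ContinuousOn q' (Icc 0 1)) : ContDiffOn ℝ 1 q (Icc 0 1) := by
  have hu : UniqueDiffOn ℝ (Icc (0 : ℝ) 1) := uniqueDiffOn_Icc zero_lt_one
  rw [contDiffOn_one_iff_derivWithin hu]
  exact ⟨fun x hx => (h x hx).differentiableWithinAt,
    hc.congr fun x hx => (h x hx).derivWithin (hu x hx)⟩

theorem contDiffOn_two_of_hasDerivWithinAt
    (h : ∀ x ∈ Icc (0 : ℝ) 1, HasDerivWithinAt q (q' x) (Icc 0 1) x)
    (h' : ∀ x ∈ Icc (0 : ℝ) 1, HasDerivWithinAt q' (q'' x) (Icc 0 1) x)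
    (hc : ContinuousOn q'' (Icc 0 1)) : ContDiffOn ℝ 2 q (Icc 0 1) := by
  have hu : UniqueDiffOn ℝ (Icc (0 : ℝ) 1) := uniqueDiffOn_Icc zero_lt_one
  rw [show (2 : WithTop ℕ∞) = 1 + 1 by norm_num, contDiffOn_succ_iff_derivWithin hu]
  exact ⟨fun x hx => (h x hx).differentiableWithinAt, by simp,
    (contDiffOn_one_of_hasDerivWithinAt h' hc).congr fun x hx => (h x hx).derivWithin (hu x hx)⟩

theorem dx_eq (hx : x ∈ Icc (0 : ℝ) 1) {m : ℝ} (h : HasDerivWithinAt q m (Icc 0 1) x) :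
    dx q x = m :=
  h.derivWithin (uniqueDiffOn_Icc zero_lt_one x hx)

theorem dx_congr (h : EqOn q q' (Icc 0 1)) (hx : x ∈ Icc (0 : ℝ) 1) : dx q x = dx q' x :=
  derivWithin_congr h (h hx)

theorem hasDerivWithinAt_dx (hq : ContDiffOn ℝ 1 q (Icc 0 1)) (hx : x ∈ Icc (0 : ℝ) 1) :
    HasDerivWithinAt q (dx q x) (Icc 0 1) x :=
  (hq.differentiableOn one_ne_zero x hx).hasDerivWithinAt

theorem contDiffOn_dx (hq : ContDiffOn ℝ 2 q (Icc 0 1)) : ContDiffOn ℝ 1 (dx q) (Icc 0 1) :=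
  hq.derivWithin (uniqueDiffOn_Icc zero_lt_one) (by norm_num)

theorem continuousOn_dx (hq : ContDiffOn ℝ 1 q (Icc 0 1)) : ContinuousOn (dx q) (Icc 0 1) :=
  hq.continuousOn_derivWithin (uniqueDiffOn_Icc zero_lt_one) le_rfl

theorem integral_dx (hq : ContDiffOn ℝ 1 q (Icc 0 1)) (hx : x ∈ Icc (0 : ℝ) 1) :
    ∫ y in (0 : ℝ)..x, dx q y = q x - q 0 := by
  have hsub : Icc 0 x ⊆ Icc (0 : ℝ) 1 := Icc_subset_Icc_right hx.2
  refine intervalIntegral.integral_eq_sub_of_hasDerivAt_of_le hx.1 (hq.continuousOn.mono hsub)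
    (fun y hy => ?_) (((continuousOn_dx hq).mono hsub).intervalIntegrable_of_Icc hx.1)
  exact (hasDerivWithinAt_dx hq (hsub (Ioo_subset_Icc_self hy))).hasDerivAt
    (Icc_mem_nhds hy.1 (hy.2.trans_le hx.2))

end UnitInterval

theorem surjective_of_pos_le_hasDerivAt {q q' : ℝ → ℝ} {m : ℝ} (hm : 0 < m)
    (hd : ∀ x, HasDerivAt q (q' x) x) (hle : ∀ x, m ≤ q' x) : Surjective q := by
  have hmono : Monotone fun x => q x - x * m :=
    monotone_of_hasDerivAt_nonneg (fun x => (hd x).fun_sub ((hasDerivAt_id x).mul_const m))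
      fun x => by simpa using hle x
  have hcont : Continuous q := continuous_iff_continuousAt.2 fun x => (hd x).continuousAt
  refine hcont.surjective ?_ ?_
  · refine tendsto_atTop_mono' atTop ?_
      (tendsto_atTop_add_const_right atTop (q 0) (tendsto_id.atTop_mul_const hm))
    filter_upwards [eventually_ge_atTop 0] with x hx
    simpa [add_comm, le_sub_iff_add_le] using hmono hx
  · refine tendsto_atBot_mono' atBot ?_
      (tendsto_atBot_add_const_right atBot (q 0) (tendsto_id.atBot_mul_const hm))
    filter_upwards [eventually_le_atBot 0] with x hx
    simpa [add_comm] using hmono hx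

/-- The problem in Lagrangian coordinates, on the time interval `(a, b)`. The function `w` is the
reciprocal of the Jacobian of the particle flow; it solves the linear equation
`w_tt + c(t) w = r(x)`, in which `c` is determined by the requirement that the Jacobian has mean
one. The labels range over all of `ℝ`, but only those in `[0, 1]` matter, and the spatial
derivatives are taken there. -/
structure LagrangianFlow where
  (h r r' : ℝ → ℝ)
  (a b : ℝ)
  (w wt wx wtx : ℝ → ℝ → ℝ)
  c : ℝ → ℝ
  zero_mem : (0 : ℝ) ∈ Ioo a b
  continuous_r : Continuous r
  deriv_r : ∀ x ∈ Icc (0 : ℝ) 1, HasDerivWithinAt r (r' x) (Icc 0 1) x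
  continuousOn_r' : ContinuousOn r' (Icc 0 1)
  r_zero : r 0 = 0
  r_one : r 1 = 0
  continuousOn_w : ContinuousOn (uncurry w) (Ioo a b ×ˢ univ)
  continuousOn_wt : ContinuousOn (uncurry wt) (Ioo a b ×ˢ univ)
  continuousOn_wx : ContinuousOn (uncurry wx) (Ioo a b ×ˢ Icc 0 1)
  continuousOn_wtx : ContinuousOn (uncurry wtx) (Ioo a b ×ˢ Icc 0 1)
  continuousOn_c : ContinuousOn c (Ioo a b)
  w_pos : ∀ t ∈ Ioo a b, ∀ x, 0 < w t x
  exists_w_le : ∀ t ∈ Ioo a b, ∃ B, ∀ x, w t x ≤ B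
  deriv_w : ∀ t ∈ Ioo a b, ∀ x, HasDerivAt (fun s => w s x) (wt t x) t
  deriv_wt : ∀ t ∈ Ioo a b, ∀ x, HasDerivAt (fun s => wt s x) (r x - c t * w t x) t
  deriv_wx : ∀ t ∈ Ioo a b, ∀ x ∈ Icc (0 : ℝ) 1, HasDerivWithinAt (w t) (wx t x) (Icc 0 1) x
  deriv_wtx : ∀ t ∈ Ioo a b, ∀ x ∈ Icc (0 : ℝ) 1, HasDerivWithinAt (wt t) (wtx t x) (Icc 0 1) x
  integral_inv_w : ∀ t ∈ Ioo a b, ∫ x in (0 : ℝ)..1, (w t x)⁻¹ = 1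
  init_w : ∀ x, w 0 x = 1
  init_wt : ∀ x, wt 0 x = -h x

namespace LagrangianFlow

variable (L : LagrangianFlow) {t x : ℝ}

/-- The trajectory of the particle with label `x`. -/
def flowMap (t x : ℝ) : ℝ := ∫ a in (0 : ℝ)..x, (L.w t a)⁻¹

/-- The back-to-labels map, the spatial inverse of `flowMap`. -/
def labelMap (t : ℝ) : ℝ → ℝ := invFun (L.flowMap t)

/-- The Eulerian velocity `f`, the time derivative of `flowMap` at a fixed label. -/
def velocity (t x : ℝ) : ℝ := ∫ a in (0 : ℝ)..L.labelMap t x, -L.wt t a / L.w t a ^ 2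

/-- The Eulerian velocity gradient `f_x`. -/
def strain (t x : ℝ) : ℝ := -L.wt t (L.labelMap t x) / L.w t (L.labelMap t x)

/-- The Eulerian temperature `ρ`. -/
def temp (t x : ℝ) : ℝ := L.r (L.labelMap t x) / L.w t (L.labelMap t x)

/-- The second derivative `f_xx` of the velocity. -/
def strainGrad (t x : ℝ) : ℝ :=
  L.wt t (L.labelMap t x) * L.wx t (L.labelMap t x) / L.w t (L.labelMap t x)
    - L.wtx t (L.labelMap t x)

/-- The derivative `ρ_x` of the temperature. -/
def tempGrad (t x : ℝ) : ℝ :=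
  L.r' (L.labelMap t x)
    - L.r (L.labelMap t x) * L.wx t (L.labelMap t x) / L.w t (L.labelMap t x)

theorem continuousOn_inv_w : ContinuousOn (uncurry fun t x => (L.w t x)⁻¹) (Ioo L.a L.b ×ˢ univ) :=
  L.continuousOn_w.inv₀ fun p hp => (L.w_pos p.1 hp.1 p.2).ne'

theorem continuousOn_deriv_inv_w :
    ContinuousOn (uncurry fun t x => -L.wt t x / L.w t x ^ 2) (Ioo L.a L.b ×ˢ univ) :=
  L.continuousOn_wt.neg.div (L.continuousOn_w.pow 2)
    fun p hp => (pow_pos (L.w_pos p.1 hp.1 p.2) 2).ne'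

theorem hasDerivAt_inv_w (ht : t ∈ Ioo L.a L.b) (x : ℝ) :
    HasDerivAt (fun s => (L.w s x)⁻¹) (-L.wt t x / L.w t x ^ 2) t :=
  (L.deriv_w t ht x).inv (L.w_pos t ht x).ne'

section LabelMap

theorem hasDerivAt_flowMap (ht : t ∈ Ioo L.a L.b) (x : ℝ) :
    HasDerivAt (L.flowMap t) (L.w t x)⁻¹ x :=
  ((continuous_slice L.continuousOn_inv_w ht).integral_hasStrictDerivAt 0 x).hasDerivAt

theorem continuousOn_flowMap :
    ContinuousOn (uncurry L.flowMap) (Ioo L.a L.b ×ˢ univ) :=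
  continuousOn_parametric_primitive L.continuousOn_inv_w 0

theorem strictMono_flowMap (ht : t ∈ Ioo L.a L.b) : StrictMono (L.flowMap t) :=
  strictMono_of_hasDerivAt_pos (L.hasDerivAt_flowMap ht) fun x => inv_pos.2 (L.w_pos t ht x)

theorem surjective_flowMap (ht : t ∈ Ioo L.a L.b) : Surjective (L.flowMap t) := by
  obtain ⟨B, hB⟩ := L.exists_w_le t ht
  exact surjective_of_pos_le_hasDerivAt (inv_pos.2 ((L.w_pos t ht 0).trans_le (hB 0)))
    (L.hasDerivAt_flowMap ht) fun x => inv_anti₀ (L.w_pos t ht x) (hB x)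

theorem flowMap_labelMap (ht : t ∈ Ioo L.a L.b) (x : ℝ) : L.flowMap t (L.labelMap t x) = x :=
  rightInverse_invFun (L.surjective_flowMap ht) x

theorem labelMap_flowMap (ht : t ∈ Ioo L.a L.b) (x : ℝ) : L.labelMap t (L.flowMap t x) = x :=
  leftInverse_invFun (L.strictMono_flowMap ht).injective x

theorem labelMap_zero (ht : t ∈ Ioo L.a L.b) : L.labelMap t 0 = 0 := by
  simpa [flowMap] using L.labelMap_flowMap ht 0

theorem labelMap_one (ht : t ∈ Ioo L.a L.b) : L.labelMap t 1 = 1 := by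
  simpa [flowMap, L.integral_inv_w t ht] using L.labelMap_flowMap ht 1

theorem labelMap_boundary (ht : t ∈ Ioo L.a L.b) (hx : x = 0 ∨ x = 1) : L.labelMap t x = x := by
  rcases hx with rfl | rfl
  · exact L.labelMap_zero ht
  · exact L.labelMap_one ht

theorem labelMap_init (x : ℝ) : L.labelMap 0 x = x := by
  simpa [flowMap, L.init_w] using L.labelMap_flowMap L.zero_mem x

theorem monotone_labelMap (ht : t ∈ Ioo L.a L.b) : Monotone (L.labelMap t) := fun x y hxy => by
  rwa [← (L.strictMono_flowMap ht).le_iff_le, L.flowMap_labelMap ht, L.flowMap_labelMap ht]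

theorem labelMap_mem (ht : t ∈ Ioo L.a L.b) (hx : x ∈ Icc (0 : ℝ) 1) :
    L.labelMap t x ∈ Icc (0 : ℝ) 1 := by
  simpa only [L.labelMap_zero ht, L.labelMap_one ht] using (L.monotone_labelMap ht).mapsTo_Icc hx

theorem continuousOn_labelMap : ContinuousOn (uncurry L.labelMap) (Ioo L.a L.b ×ˢ univ) :=
  continuousOn_parametric_inverse (G := L.flowMap)
    (fun y => L.continuousOn_flowMap.comp (f := fun t => (t, y)) (by fun_prop)
      fun _ ht => ⟨ht, mem_univ _⟩)
    (fun _ ht => L.strictMono_flowMap ht) fun _ ht x _ => L.flowMap_labelMap ht x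

theorem hasDerivAt_labelMap (ht : t ∈ Ioo L.a L.b) (x : ℝ) :
    HasDerivAt (L.labelMap t) (L.w t (L.labelMap t x)) x := by
  have := HasDerivAt.of_local_left_inverse (g := L.labelMap t)
    (continuous_slice L.continuousOn_labelMap ht).continuousAt
    (L.hasDerivAt_flowMap ht (L.labelMap t x)) (inv_ne_zero (L.w_pos t ht _).ne')
    (Eventually.of_forall (L.flowMap_labelMap ht))
  rwa [inv_inv] at this

theorem hasDerivAt_labelMap_time (ht : t ∈ Ioo L.a L.b) (x : ℝ) :
    HasDerivAt (fun s => L.labelMap s x) (-L.velocity t x * L.w t (L.labelMap t x)) t := by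
  have hI : Ioo L.a L.b ∈ 𝓝 t := isOpen_Ioo.mem_nhds ht
  have flowMap_deriv := hasFDerivAt_parametric_primitive isOpen_Ioo L.continuousOn_inv_w
    L.continuousOn_deriv_inv_w (fun s hs => L.hasDerivAt_inv_w hs) (x := L.labelMap t x) (c := 0) ht
  have labelMap_cont : ContinuousAt (fun s => L.labelMap s x) t :=
    (L.continuousOn_labelMap.continuousAt (prod_mem_nhds hI univ_mem)).comp
      (f := fun s : ℝ => (s, x)) (by fun_prop)
  have labelMap_deriv := hasDerivAt_parametric_inverse flowMap_deriv
    (inv_ne_zero (L.w_pos t ht _).ne') labelMap_cont (x := x)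
    (by filter_upwards [hI] with s hs using L.flowMap_labelMap hs x)
  rwa [div_inv_eq_mul] at labelMap_deriv

theorem hasDerivWithinAt_comp_labelMap (ht : t ∈ Ioo L.a L.b) {q : ℝ → ℝ} {q' : ℝ}
    (hq : HasDerivWithinAt q q' (Icc 0 1) (L.labelMap t x)) :
    HasDerivWithinAt (fun y => q (L.labelMap t y)) (q' * L.w t (L.labelMap t x)) (Icc 0 1) x :=
  hq.comp x (L.hasDerivAt_labelMap ht x).hasDerivWithinAt fun _ hy => L.labelMap_mem ht hy

theorem hasDerivAt_along_labelMap (ht : t ∈ Ioo L.a L.b) (hx : x ∈ Icc (0 : ℝ) 1)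
    {F F' : ℝ → ℝ → ℝ} {Fx : ℝ}
    (hd : ∀ s ∈ Ioo L.a L.b, ∀ y, HasDerivAt (fun s => F s y) (F' s y) s)
    (hF' : ContinuousOn (uncurry F') (Ioo L.a L.b ×ˢ univ))
    (hFx : HasDerivWithinAt (F t) Fx (Icc 0 1) (L.labelMap t x)) :
    HasDerivAt (fun s => F s (L.labelMap s x))
      (F' t (L.labelMap t x) + Fx * (-L.velocity t x * L.w t (L.labelMap t x))) t := by
  have hI : Ioo L.a L.b ∈ 𝓝 t := isOpen_Ioo.mem_nhds ht
  refine hasDerivAt_along_curve (U := Icc 0 1) ?_ ?_ hFx (L.hasDerivAt_labelMap_time ht x) ?_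
  · filter_upwards [hI] with s hs y _ using hd s hs y
  · exact (hF'.continuousAt (prod_mem_nhds hI univ_mem)).continuousWithinAt
  · filter_upwards [hI] with s hs using L.labelMap_mem hs hx

theorem continuousOn_comp_labelMap {F : ℝ → ℝ → ℝ}
    (hF : ContinuousOn (uncurry F) (Ioo L.a L.b ×ˢ Icc 0 1)) :
    ContinuousOn (fun p : ℝ × ℝ => F p.1 (L.labelMap p.1 p.2)) (Ioo L.a L.b ×ˢ Icc 0 1) :=
  hF.comp
    (continuousOn_fst.prodMk (L.continuousOn_labelMap.mono (prod_mono le_rfl (subset_univ _))))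
    fun _ hp => ⟨hp.1, L.labelMap_mem hp.1 hp.2⟩

end LabelMap

section SpaceDerivatives

theorem hasDerivAt_velocity (ht : t ∈ Ioo L.a L.b) (x : ℝ) :
    HasDerivAt (L.velocity t) (L.strain t x) x := by
  have hw := (L.w_pos t ht (L.labelMap t x)).ne'
  have := ((continuous_slice L.continuousOn_deriv_inv_w ht).integral_hasStrictDerivAt 0
    (L.labelMap t x)).hasDerivAt.comp x (L.hasDerivAt_labelMap ht x)
  refine this.congr_deriv ?_
  rw [strain]
  field_simp

theorem hasDerivWithinAt_strain (ht : t ∈ Ioo L.a L.b) (hx : x ∈ Icc (0 : ℝ) 1) :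
    HasDerivWithinAt (L.strain t) (L.strainGrad t x) (Icc 0 1) x := by
  have hy := L.labelMap_mem ht hx
  have hw := (L.w_pos t ht (L.labelMap t x)).ne'
  refine ((L.hasDerivWithinAt_comp_labelMap ht (L.deriv_wtx t ht _ hy)).fun_neg.div
    (L.hasDerivWithinAt_comp_labelMap ht (L.deriv_wx t ht _ hy)) hw).congr_deriv ?_
  rw [strainGrad]
  field_simp
  ring

theorem hasDerivWithinAt_temp (ht : t ∈ Ioo L.a L.b) (hx : x ∈ Icc (0 : ℝ) 1) :
    HasDerivWithinAt (L.temp t) (L.tempGrad t x) (Icc 0 1) x := by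
  have hy := L.labelMap_mem ht hx
  have hw := (L.w_pos t ht (L.labelMap t x)).ne'
  refine ((L.hasDerivWithinAt_comp_labelMap ht (L.deriv_r _ hy)).div
    (L.hasDerivWithinAt_comp_labelMap ht (L.deriv_wx t ht _ hy)) hw).congr_deriv ?_
  rw [tempGrad]
  field_simp

theorem dx_velocity (ht : t ∈ Ioo L.a L.b) (hx : x ∈ Icc (0 : ℝ) 1) :
    dx (L.velocity t) x = L.strain t x :=
  dx_eq hx (L.hasDerivAt_velocity ht x).hasDerivWithinAt

theorem dx_dx_velocity (ht : t ∈ Ioo L.a L.b) (hx : x ∈ Icc (0 : ℝ) 1) :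
    dx (dx (L.velocity t)) x = L.strainGrad t x :=
  (dx_congr (fun _ hy => L.dx_velocity ht hy) hx).trans
    (dx_eq hx (L.hasDerivWithinAt_strain ht hx))

theorem dx_temp (ht : t ∈ Ioo L.a L.b) (hx : x ∈ Icc (0 : ℝ) 1) :
    dx (L.temp t) x = L.tempGrad t x :=
  dx_eq hx (L.hasDerivWithinAt_temp ht hx)

end SpaceDerivatives

section TimeDerivatives

theorem continuousOn_deriv_wt :
    ContinuousOn (uncurry fun t x => L.r x - L.c t * L.w t x) (Ioo L.a L.b ×ˢ univ) :=
  (L.continuous_r.comp_continuousOn continuousOn_snd).sub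
    ((L.continuousOn_c.comp continuousOn_fst fun _ hp => hp.1).mul L.continuousOn_w)

theorem hasDerivAt_strain_time (ht : t ∈ Ioo L.a L.b) (hx : x ∈ Icc (0 : ℝ) 1) :
    HasDerivAt (fun s => L.strain s x)
      (L.c t - L.velocity t x * L.strainGrad t x + L.strain t x ^ 2 - L.temp t x) t := by
  have hy := L.labelMap_mem ht hx
  have hw := (L.w_pos t ht (L.labelMap t x)).ne'
  have deriv_w :=
    L.hasDerivAt_along_labelMap ht hx L.deriv_w L.continuousOn_wt (L.deriv_wx t ht _ hy)
  have deriv_wt :=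
    L.hasDerivAt_along_labelMap ht hx L.deriv_wt L.continuousOn_deriv_wt (L.deriv_wtx t ht _ hy)
  refine (deriv_wt.fun_neg.div deriv_w hw).congr_deriv ?_
  rw [strainGrad, strain, temp]
  field_simp
  ring

theorem hasDerivAt_temp_time (ht : t ∈ Ioo L.a L.b) (hx : x ∈ Icc (0 : ℝ) 1) :
    HasDerivAt (fun s => L.temp s x)
      (L.temp t x * L.strain t x - L.velocity t x * L.tempGrad t x) t := by
  have hy := L.labelMap_mem ht hx
  have hw := (L.w_pos t ht (L.labelMap t x)).ne'
  have deriv_w :=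
    L.hasDerivAt_along_labelMap ht hx L.deriv_w L.continuousOn_wt (L.deriv_wx t ht _ hy)
  have deriv_r := L.hasDerivAt_along_labelMap ht hx (F := fun _ => L.r) (F' := fun _ _ => 0)
    (fun s _ y => hasDerivAt_const s (L.r y)) continuousOn_const (L.deriv_r _ hy)
  refine (deriv_r.div deriv_w hw).congr_deriv ?_
  rw [tempGrad, strain, temp]
  field_simp
  ring

end TimeDerivatives

section Continuity

theorem w_labelMap_ne_zero :
    ∀ p ∈ Ioo L.a L.b ×ˢ Icc (0 : ℝ) 1, L.w p.1 (L.labelMap p.1 p.2) ≠ 0 :=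
  fun p hp => (L.w_pos p.1 hp.1 _).ne'

theorem continuousOn_w_labelMap :
    ContinuousOn (fun p : ℝ × ℝ => L.w p.1 (L.labelMap p.1 p.2)) (Ioo L.a L.b ×ˢ Icc 0 1) :=
  L.continuousOn_comp_labelMap (L.continuousOn_w.mono (prod_mono le_rfl (subset_univ _)))

theorem continuousOn_wt_labelMap :
    ContinuousOn (fun p : ℝ × ℝ => L.wt p.1 (L.labelMap p.1 p.2)) (Ioo L.a L.b ×ˢ Icc 0 1) :=
  L.continuousOn_comp_labelMap (L.continuousOn_wt.mono (prod_mono le_rfl (subset_univ _)))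

theorem continuousOn_r_labelMap :
    ContinuousOn (fun p : ℝ × ℝ => L.r (L.labelMap p.1 p.2)) (Ioo L.a L.b ×ˢ Icc 0 1) :=
  L.continuousOn_comp_labelMap (F := fun _ => L.r)
    (L.continuous_r.comp continuous_snd).continuousOn

theorem continuousOn_velocity :
    ContinuousOn (uncurry L.velocity) (Ioo L.a L.b ×ˢ Icc 0 1) :=
  L.continuousOn_comp_labelMap (F := fun t y => ∫ a in (0 : ℝ)..y, -L.wt t a / L.w t a ^ 2)
    ((continuousOn_parametric_primitive L.continuousOn_deriv_inv_w 0).mono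
      (prod_mono le_rfl (subset_univ _)))

theorem continuousOn_strain :
    ContinuousOn (uncurry L.strain) (Ioo L.a L.b ×ˢ Icc 0 1) :=
  L.continuousOn_wt_labelMap.neg.div L.continuousOn_w_labelMap L.w_labelMap_ne_zero

theorem continuousOn_strainGrad :
    ContinuousOn (uncurry L.strainGrad) (Ioo L.a L.b ×ˢ Icc 0 1) :=
  ((L.continuousOn_wt_labelMap.mul (L.continuousOn_comp_labelMap L.continuousOn_wx)).div
    L.continuousOn_w_labelMap L.w_labelMap_ne_zero).sub
      (L.continuousOn_comp_labelMap L.continuousOn_wtx)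

theorem continuousOn_temp :
    ContinuousOn (uncurry L.temp) (Ioo L.a L.b ×ˢ Icc 0 1) :=
  L.continuousOn_r_labelMap.div L.continuousOn_w_labelMap L.w_labelMap_ne_zero

theorem continuousOn_tempGrad :
    ContinuousOn (uncurry L.tempGrad) (Ioo L.a L.b ×ˢ Icc 0 1) :=
  (L.continuousOn_comp_labelMap (F := fun _ => L.r')
    (L.continuousOn_r'.comp continuousOn_snd fun _ hp => hp.2)).sub
      ((L.continuousOn_r_labelMap.mul (L.continuousOn_comp_labelMap L.continuousOn_wx)).div
        L.continuousOn_w_labelMap L.w_labelMap_ne_zero)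

end Continuity

section NonlocalTerm

theorem velocity_zero (ht : t ∈ Ioo L.a L.b) : L.velocity t 0 = 0 := by
  simp [velocity, L.labelMap_zero ht]

theorem velocity_one (ht : t ∈ Ioo L.a L.b) : L.velocity t 1 = 0 := by
  have deriv_integral := hasDerivAt_parametric_integral isOpen_Ioo zero_le_one
    (fun s hs => (continuous_slice L.continuousOn_inv_w hs).continuousOn)
    (L.continuousOn_deriv_inv_w.mono (prod_mono le_rfl (subset_univ (Icc (0 : ℝ) 1))))
    (fun s hs y _ => L.hasDerivAt_inv_w hs y) ht
  have deriv_one : HasDerivAt (fun s => ∫ y in (0 : ℝ)..1, (L.w s y)⁻¹) 0 t :=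
    (hasDerivAt_const t (1 : ℝ)).congr_of_eventuallyEq (by
      filter_upwards [isOpen_Ioo.mem_nhds ht] with s hs using L.integral_inv_w s hs)
  rw [velocity, L.labelMap_one ht]
  exact deriv_integral.unique deriv_one

theorem integral_strain (ht : t ∈ Ioo L.a L.b) : ∫ x in (0 : ℝ)..1, L.strain t x = 0 := by
  rw [intervalIntegral.integral_eq_sub_of_hasDerivAt (fun x _ => L.hasDerivAt_velocity ht x)
    ((continuousOn_slice L.continuousOn_strain ht).intervalIntegrable_of_Icc zero_le_one),
    L.velocity_zero ht, L.velocity_one ht, sub_zero]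

theorem integral_strain_sq_add_velocity_mul_strainGrad (ht : t ∈ Ioo L.a L.b) :
    ∫ x in (0 : ℝ)..1, (L.strain t x * L.strain t x + L.velocity t x * L.strainGrad t x) = 0 := by
  have cont_f := continuousOn_slice L.continuousOn_velocity ht
  have cont_fx := continuousOn_slice L.continuousOn_strain ht
  have cont_fxx := continuousOn_slice L.continuousOn_strainGrad ht
  rw [intervalIntegral.integral_eq_sub_of_hasDerivAt_of_le
    (f := fun x => L.velocity t x * L.strain t x) zero_le_one (cont_f.mul cont_fx)
    (fun x hx => (L.hasDerivAt_velocity ht x).mul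
      ((L.hasDerivWithinAt_strain ht (Ioo_subset_Icc_self hx)).hasDerivAt
        (Icc_mem_nhds hx.1 hx.2)))
    (((cont_fx.mul cont_fx).add (cont_f.mul cont_fxx)).intervalIntegrable_of_Icc zero_le_one),
    L.velocity_zero ht, L.velocity_one ht, zero_mul, zero_mul, sub_zero]

theorem integral_strain_time_deriv (ht : t ∈ Ioo L.a L.b) :
    ∫ x in (0 : ℝ)..1,
      (L.c t - L.velocity t x * L.strainGrad t x + L.strain t x ^ 2 - L.temp t x) = 0 := by
  have cont_c : ContinuousOn (fun p : ℝ × ℝ => L.c p.1) (Ioo L.a L.b ×ˢ Icc 0 1) :=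
    L.continuousOn_c.comp continuousOn_fst fun _ hp => hp.1
  have deriv_integral := hasDerivAt_parametric_integral (F' := fun t x => L.c t - L.velocity t x *
      L.strainGrad t x + L.strain t x ^ 2 - L.temp t x) isOpen_Ioo zero_le_one
    (fun s hs => continuousOn_slice L.continuousOn_strain hs)
    (by exact ((cont_c.sub (L.continuousOn_velocity.mul L.continuousOn_strainGrad)).add
      (L.continuousOn_strain.pow 2)).sub L.continuousOn_temp)
    (fun s hs y hy => L.hasDerivAt_strain_time hs hy) ht
  have deriv_zero : HasDerivAt (fun s => ∫ x in (0 : ℝ)..1, L.strain s x) 0 t :=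
    (hasDerivAt_const t (0 : ℝ)).congr_of_eventuallyEq (by
      filter_upwards [isOpen_Ioo.mem_nhds ht] with s hs using L.integral_strain hs)
  exact deriv_integral.unique deriv_zero

theorem nonlocalTerm_eq (ht : t ∈ Ioo L.a L.b) : nonlocalTerm L.velocity L.temp t = L.c t := by
  have cont_f := continuousOn_slice L.continuousOn_velocity ht
  have cont_fx := continuousOn_slice L.continuousOn_strain ht
  have cont_fxx := continuousOn_slice L.continuousOn_strainGrad ht
  have int_c : IntervalIntegrable (fun _ : ℝ => L.c t) volume 0 1 := intervalIntegrable_const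
  have int_sq : IntervalIntegrable (fun x => L.strain t x ^ 2) volume 0 1 :=
    (cont_fx.pow 2).intervalIntegrable_of_Icc zero_le_one
  have int_mul : IntervalIntegrable (fun x => L.velocity t x * L.strainGrad t x) volume 0 1 :=
    (cont_f.mul cont_fxx).intervalIntegrable_of_Icc zero_le_one
  have int_temp : IntervalIntegrable (L.temp t) volume 0 1 :=
    (continuousOn_slice L.continuousOn_temp ht).intervalIntegrable_of_Icc zero_le_one
  have dx_sq : ∫ x in (0 : ℝ)..1, dx (L.velocity t) x ^ 2 = ∫ x in (0 : ℝ)..1, L.strain t x ^ 2 :=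
    intervalIntegral.integral_congr fun y hy => by
      rw [uIcc_of_le zero_le_one] at hy
      simp only [L.dx_velocity ht hy]
  have by_parts := L.integral_strain_sq_add_velocity_mul_strainGrad ht
  have time_deriv := L.integral_strain_time_deriv ht
  simp only [← pow_two] at by_parts
  rw [intervalIntegral.integral_add int_sq int_mul] at by_parts
  rw [intervalIntegral.integral_sub ((int_c.sub int_mul).add int_sq) int_temp,
    intervalIntegral.integral_add (int_c.sub int_mul) int_sq,
    intervalIntegral.integral_sub int_c int_mul, intervalIntegral.integral_const, sub_zero,
    one_smul] at time_deriv
  rw [nonlocalTerm, dx_sq]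
  linarith

end NonlocalTerm

section ClassicalSolution

theorem dx_velocity_eventuallyEq (ht : t ∈ Ioo L.a L.b) (hx : x ∈ Icc (0 : ℝ) 1) :
    (fun s => dx (L.velocity s) x) =ᶠ[𝓝 t] fun s => L.strain s x := by
  filter_upwards [isOpen_Ioo.mem_nhds ht] with s hs using L.dx_velocity hs hx

theorem momentum_eq (ht : t ∈ Ioo L.a L.b) (hx : x ∈ Icc (0 : ℝ) 1) :
    deriv (fun s => dx (L.velocity s) x) t + L.velocity t x * dx (dx (L.velocity t)) x
      - dx (L.velocity t) x ^ 2 + L.temp t x = nonlocalTerm L.velocity L.temp t := by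
  rw [(L.dx_velocity_eventuallyEq ht hx).deriv_eq, (L.hasDerivAt_strain_time ht hx).deriv,
    L.dx_velocity ht hx, L.dx_dx_velocity ht hx, L.nonlocalTerm_eq ht]
  ring

theorem temperature_eq (ht : t ∈ Ioo L.a L.b) (hx : x ∈ Icc (0 : ℝ) 1) :
    deriv (fun s => L.temp s x) t + L.velocity t x * dx (L.temp t) x
      = L.temp t x * dx (L.velocity t) x := by
  rw [(L.hasDerivAt_temp_time ht hx).deriv, L.dx_velocity ht hx, L.dx_temp ht hx]
  ring

theorem Ico_zero_subset : Ico 0 L.b ⊆ Ioo L.a L.b :=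
  fun _ ht => ⟨L.zero_mem.1.trans_le ht.1, ht.2⟩

theorem isClassicalSolution {f₀ ρ₀ : ℝ → ℝ}
    (hf₀ : ∀ x ∈ Icc (0 : ℝ) 1, f₀ x = ∫ y in (0 : ℝ)..x, L.h y)
    (hρ₀ : ∀ x ∈ Icc (0 : ℝ) 1, ρ₀ x = L.r x) :
    IsClassicalSolution f₀ ρ₀ L.b L.velocity L.temp := by
  have hsub := L.Ico_zero_subset
  have hsub_open : Ioo 0 L.b ⊆ Ioo L.a L.b := Ioo_subset_Ico_self.trans hsub
  have hsub_prod := prod_mono_left (t := Icc (0 : ℝ) 1) hsub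
  exact {
    contDiff_f := fun t ht => contDiffOn_two_of_hasDerivWithinAt
      (fun x _ => (L.hasDerivAt_velocity (hsub ht) x).hasDerivWithinAt)
      (fun x hx => L.hasDerivWithinAt_strain (hsub ht) hx)
      (continuousOn_slice L.continuousOn_strainGrad (hsub ht))
    contDiff_rho := fun t ht => contDiffOn_one_of_hasDerivWithinAt
      (fun x hx => L.hasDerivWithinAt_temp (hsub ht) hx)
      (continuousOn_slice L.continuousOn_tempGrad (hsub ht))
    continuous_f := L.continuousOn_velocity.mono hsub_prod
    continuous_fx := (L.continuousOn_strain.mono hsub_prod).congr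
      fun p hp => L.dx_velocity (hsub hp.1) hp.2
    continuous_fxx := (L.continuousOn_strainGrad.mono hsub_prod).congr
      fun p hp => L.dx_dx_velocity (hsub hp.1) hp.2
    continuous_rho := L.continuousOn_temp.mono hsub_prod
    continuous_rhox := (L.continuousOn_tempGrad.mono hsub_prod).congr
      fun p hp => L.dx_temp (hsub hp.1) hp.2
    differentiable_fx := fun t ht x hx =>
      ((L.hasDerivAt_strain_time (hsub_open ht) hx).congr_of_eventuallyEq
        (L.dx_velocity_eventuallyEq (hsub_open ht) hx)).differentiableAt
    differentiable_rho := fun t ht x hx =>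
      (L.hasDerivAt_temp_time (hsub_open ht) hx).differentiableAt
    momentum := fun t ht x hx => L.momentum_eq (hsub_open ht) hx
    temperature := fun t ht x hx => L.temperature_eq (hsub_open ht) hx
    initial_f := fun x hx => by
      simp [velocity, L.labelMap_init, L.init_w, L.init_wt, hf₀ x hx]
    initial_rho := fun x hx => by simp [temp, L.labelMap_init, L.init_w, hρ₀ x hx]
    boundary_f := fun t ht => ⟨L.velocity_zero (hsub ht), L.velocity_one (hsub ht)⟩
    boundary_rho := fun t ht => by
      simp [temp, L.labelMap_zero (hsub ht), L.labelMap_one (hsub ht), L.r_zero, L.r_one] }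

end ClassicalSolution

theorem integral_dx_boundary (ht : t ∈ Ico 0 L.b) (hx : x = 0 ∨ x = 1) :
    ∫ s in (0 : ℝ)..t, dx (L.velocity s) x = -Real.log (L.w t x) := by
  have hsub : Icc 0 t ⊆ Ioo L.a L.b :=
    (Icc_subset_Ico_right ht.2).trans L.Ico_zero_subset
  have hxI : x ∈ Icc (0 : ℝ) 1 := by rcases hx with rfl | rfl <;> simp
  have strain_eq : EqOn (fun s => dx (L.velocity s) x) (fun s => -(L.wt s x / L.w s x))
      (uIcc 0 t) := fun s hs => by
    rw [uIcc_of_le ht.1] at hs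
    simp only [L.dx_velocity (hsub hs) hxI, strain, L.labelMap_boundary (hsub hs) hx, neg_div]
  have continuousOn_time : ∀ {G : ℝ → ℝ → ℝ}, ContinuousOn (uncurry G) (Ioo L.a L.b ×ˢ univ) →
      ContinuousOn (fun s => G s x) (Icc 0 t) := fun hG =>
    hG.comp (f := fun s => (s, x)) (by fun_prop) fun s hs => ⟨hsub hs, mem_univ _⟩
  rw [intervalIntegral.integral_congr strain_eq,
    intervalIntegral.integral_eq_sub_of_hasDerivAt (f := fun s => -Real.log (L.w s x))]
  · simp [L.init_w]
  · intro s hs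
    rw [uIcc_of_le ht.1] at hs
    exact ((L.deriv_w s (hsub hs) x).log (L.w_pos s (hsub hs) x).ne').neg
  · exact (((continuousOn_time L.continuousOn_wt).div (continuousOn_time L.continuousOn_w)
      fun s hs => (L.w_pos s (hsub hs) x).ne').neg).intervalIntegrable_of_Icc ht.1

end LagrangianFlow

theorem sq_integral_le {φ : ℝ → ℝ} {a b : ℝ} (hab : a ≤ b) (hφ : ContinuousOn φ (Icc a b)) :
    (∫ y in a..b, φ y) ^ 2 ≤ (b - a) * ∫ y in a..b, φ y ^ 2 := by
  rcases hab.eq_or_lt with rfl | hlt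
  · simp
  set m := ∫ y in a..b, φ y with hm
  have int_φ : IntervalIntegrable φ volume a b := hφ.intervalIntegrable_of_Icc hab
  have int_sq : IntervalIntegrable (fun y => φ y ^ 2) volume a b :=
    (hφ.pow 2).intervalIntegrable_of_Icc hab
  have expand : ∫ y in a..b, ((b - a) * φ y - m) ^ 2
      = (b - a) * ((b - a) * (∫ y in a..b, φ y ^ 2) - m ^ 2) := by
    have : ∀ y, ((b - a) * φ y - m) ^ 2
        = (b - a) ^ 2 * φ y ^ 2 - 2 * (b - a) * m * φ y + m ^ 2 := fun y => by ring
    simp_rw [this]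
    rw [intervalIntegral.integral_add ((int_sq.const_mul _).sub (int_φ.const_mul _))
      intervalIntegrable_const, intervalIntegral.integral_sub (int_sq.const_mul _)
      (int_φ.const_mul _), intervalIntegral.integral_const_mul,
      intervalIntegral.integral_const_mul, intervalIntegral.integral_const, ← hm, smul_eq_mul]
    ring
  have nonneg : 0 ≤ ∫ y in a..b, ((b - a) * φ y - m) ^ 2 :=
    intervalIntegral.integral_nonneg hab fun _ _ => sq_nonneg _
  rw [expand] at nonneg
  exact sub_nonneg.1 (nonneg_of_mul_nonneg_right nonneg (sub_pos.2 hlt))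

theorem eq_zero_of_hasDerivAt_le_mul {E E' : ℝ → ℝ} {K t₁ : ℝ} (h0 : E 0 = 0)
    (hpos : ∀ t, 0 ≤ E t) (hc : ContinuousOn E (Icc 0 t₁))
    (hd : ∀ t ∈ Ioo 0 t₁, HasDerivAt E (E' t) t) (hle : ∀ t ∈ Ioo 0 t₁, E' t ≤ K * E t)
    {t : ℝ} (ht : t ∈ Icc 0 t₁) : E t = 0 := by
  have deriv_mul_exp : ∀ t ∈ Ioo 0 t₁, HasDerivAt (fun t => Real.exp (-K * t) * E t)
      (Real.exp (-K * t) * (-K * 1) * E t + Real.exp (-K * t) * E' t) t := fun t ht =>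
    (((hasDerivAt_id t).const_mul (-K)).exp).mul (hd t ht)
  have hanti : AntitoneOn (fun t => Real.exp (-K * t) * E t) (Icc 0 t₁) := by
    refine antitoneOn_of_hasDerivWithinAt_nonpos (convex_Icc _ _)
      (ContinuousOn.mul (by fun_prop) hc)
      (fun t ht => (deriv_mul_exp t (by rwa [interior_Icc] at ht)).hasDerivWithinAt) fun t ht => ?_
    rw [interior_Icc] at ht
    have := mul_le_mul_of_nonneg_left (hle t ht) (Real.exp_pos (-K * t)).le
    linarith
  have hle_zero := hanti (left_mem_Icc.2 (ht.1.trans ht.2)) ht ht.1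
  simp only [h0, mul_zero] at hle_zero
  exact le_antisymm (nonpos_of_mul_nonpos_right hle_zero (Real.exp_pos _)) (hpos t)

theorem two_mul_mul_le_of_abs_le {u v A C : ℝ} (hA : |A| ≤ C) :
    2 * (u * v * A) ≤ C * (u ^ 2 + v ^ 2) := by
  obtain ⟨hl, hu⟩ := abs_le.1 hA
  nlinarith [mul_nonneg (sub_nonneg.2 hu) (sq_nonneg (u + v)),
    mul_nonneg (neg_le_iff_add_nonneg'.1 hl) (sq_nonneg (u - v))]

namespace IsClassicalSolution

variable {f₀ ρ₀ : ℝ → ℝ} {T t x : ℝ} {f ρ g σ : ℝ → ℝ → ℝ}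

theorem mono (F : IsClassicalSolution f₀ ρ₀ T f ρ) {T' : ℝ} (h : T' ≤ T) :
    IsClassicalSolution f₀ ρ₀ T' f ρ := by
  have hIco : Ico 0 T' ⊆ Ico 0 T := Ico_subset_Ico_right h
  have hIoo : Ioo 0 T' ⊆ Ioo 0 T := Ioo_subset_Ioo_right h
  have hprod := prod_mono_left (t := Icc (0 : ℝ) 1) hIco
  exact ⟨fun t ht => F.contDiff_f t (hIco ht), fun t ht => F.contDiff_rho t (hIco ht),
    F.continuous_f.mono hprod, F.continuous_fx.mono hprod, F.continuous_fxx.mono hprod,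
    F.continuous_rho.mono hprod, F.continuous_rhox.mono hprod,
    fun t ht => F.differentiable_fx t (hIoo ht), fun t ht => F.differentiable_rho t (hIoo ht),
    fun t ht => F.momentum t (hIoo ht), fun t ht => F.temperature t (hIoo ht),
    F.initial_f, F.initial_rho, fun t ht => F.boundary_f t (hIco ht),
    fun t ht => F.boundary_rho t (hIco ht)⟩

theorem hasDerivWithinAt_f (F : IsClassicalSolution f₀ ρ₀ T f ρ) (ht : t ∈ Ico 0 T)
    (hx : x ∈ Icc (0 : ℝ) 1) : HasDerivWithinAt (f t) (dx (f t) x) (Icc 0 1) x :=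
  hasDerivWithinAt_dx ((F.contDiff_f t ht).of_le one_le_two) hx

theorem hasDerivWithinAt_fx (F : IsClassicalSolution f₀ ρ₀ T f ρ) (ht : t ∈ Ico 0 T)
    (hx : x ∈ Icc (0 : ℝ) 1) : HasDerivWithinAt (dx (f t)) (dx (dx (f t)) x) (Icc 0 1) x :=
  hasDerivWithinAt_dx (contDiffOn_dx (F.contDiff_f t ht)) hx

theorem hasDerivWithinAt_rho (F : IsClassicalSolution f₀ ρ₀ T f ρ) (ht : t ∈ Ico 0 T)
    (hx : x ∈ Icc (0 : ℝ) 1) : HasDerivWithinAt (ρ t) (dx (ρ t) x) (Icc 0 1) x :=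
  hasDerivWithinAt_dx (F.contDiff_rho t ht) hx

theorem hasDerivAt_fx_time (F : IsClassicalSolution f₀ ρ₀ T f ρ) (ht : t ∈ Ioo 0 T)
    (hx : x ∈ Icc (0 : ℝ) 1) : HasDerivAt (fun s => dx (f s) x)
      (nonlocalTerm f ρ t - f t x * dx (dx (f t)) x + dx (f t) x ^ 2 - ρ t x) t :=
  (F.differentiable_fx t ht x hx).hasDerivAt.congr_deriv (by linarith [F.momentum t ht x hx])

theorem hasDerivAt_rho_time (F : IsClassicalSolution f₀ ρ₀ T f ρ) (ht : t ∈ Ioo 0 T)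
    (hx : x ∈ Icc (0 : ℝ) 1) : HasDerivAt (fun s => ρ s x)
      (ρ t x * dx (f t) x - f t x * dx (ρ t) x) t :=
  (F.differentiable_rho t ht x hx).hasDerivAt.congr_deriv (by linarith [F.temperature t ht x hx])

theorem continuousOn_nonlocalTerm (F : IsClassicalSolution f₀ ρ₀ T f ρ) :
    ContinuousOn (nonlocalTerm f ρ) (Ico 0 T) :=
  (continuousOn_parametric_integral zero_le_one F.continuous_rho).sub
    ((continuousOn_parametric_integral (F := fun t x => dx (f t) x ^ 2) zero_le_one
      (by exact F.continuous_fx.pow 2)).const_mul 2)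

theorem integral_fx (F : IsClassicalSolution f₀ ρ₀ T f ρ) (ht : t ∈ Ico 0 T)
    (hx : x ∈ Icc (0 : ℝ) 1) : ∫ y in (0 : ℝ)..x, dx (f t) y = f t x := by
  rw [integral_dx ((F.contDiff_f t ht).of_le one_le_two) hx, (F.boundary_f t ht).1, sub_zero]

section Energy

/-- The pointwise energy of the difference of two solutions `(f, ρ)` and `(g, σ)`. -/
def energyDensity (f ρ g σ : ℝ → ℝ → ℝ) (t x : ℝ) : ℝ :=
  (dx (f t) x - dx (g t) x) ^ 2 + (ρ t x - σ t x) ^ 2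

/-- The energy of the difference of two solutions, which controls their distance. -/
def energy (f ρ g σ : ℝ → ℝ → ℝ) (t : ℝ) : ℝ := ∫ x in (0 : ℝ)..1, energyDensity f ρ g σ t x

/-- The time derivative of `energyDensity`, after substitution of the equations. -/
def energyDensityRate (f ρ g σ : ℝ → ℝ → ℝ) (t x : ℝ) : ℝ :=
  2 * (dx (f t) x - dx (g t) x) *
    ((nonlocalTerm f ρ t - f t x * dx (dx (f t)) x + dx (f t) x ^ 2 - ρ t x)
      - (nonlocalTerm g σ t - g t x * dx (dx (g t)) x + dx (g t) x ^ 2 - σ t x))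
  + 2 * (ρ t x - σ t x) * ((ρ t x * dx (f t) x - f t x * dx (ρ t) x)
      - (σ t x * dx (g t) x - g t x * dx (σ t) x))

/-- The spatial flux of the energy: its derivative collects the terms of `energyDensityRate` that
contain the nonlocal term, `f_xx` or `ρ_x`, and it vanishes at the endpoints. -/
def energyFlux (f ρ g σ : ℝ → ℝ → ℝ) (t x : ℝ) : ℝ :=
  2 * (nonlocalTerm f ρ t - nonlocalTerm g σ t) * (f t x - g t x)
    - f t x * energyDensity f ρ g σ t x

/-- The part of `energyDensityRate` that is not the derivative of `energyFlux`. -/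
def energySource (f ρ g σ : ℝ → ℝ → ℝ) (t x : ℝ) : ℝ :=
  dx (f t) x * ((dx (f t) x - dx (g t) x) ^ 2 + (ρ t x - σ t x) ^ 2)
  + 2 * (dx (f t) x - dx (g t) x) * (-(f t x - g t x) * dx (dx (g t)) x
    + (dx (f t) x + dx (g t) x) * (dx (f t) x - dx (g t) x) - (ρ t x - σ t x))
  + 2 * (ρ t x - σ t x) * (-(f t x - g t x) * dx (σ t) x + (ρ t x - σ t x) * dx (f t) x
    + σ t x * (dx (f t) x - dx (g t) x))

theorem energy_nonneg (t : ℝ) : 0 ≤ energy f ρ g σ t :=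
  intervalIntegral.integral_nonneg zero_le_one fun _ _ =>
    add_nonneg (sq_nonneg _) (sq_nonneg _)

theorem energySource_le {C E : ℝ} (hfx : |dx (f t) x| ≤ C) (hgx : |dx (g t) x| ≤ C)
    (hgxx : |dx (dx (g t)) x| ≤ C) (hσ : |σ t x| ≤ C) (hσx : |dx (σ t) x| ≤ C)
    (hE : (f t x - g t x) ^ 2 ≤ E) :
    energySource f ρ g σ t x ≤ (8 * C + 1) * energyDensity f ρ g σ t x + 2 * C * E := by
  unfold energySource energyDensity
  set φ := dx (f t) x - dx (g t) x
  set r := ρ t x - σ t x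
  set δ := f t x - g t x
  have hC : 0 ≤ C := (abs_nonneg _).trans hfx
  have hδ : 2 * C * δ ^ 2 ≤ 2 * C * E := by gcongr
  have hCφ : 0 ≤ C * φ ^ 2 := by positivity
  have hCr : 0 ≤ C * r ^ 2 := by positivity
  linarith [two_mul_mul_le_of_abs_le (u := φ) (v := φ) hfx,
    two_mul_mul_le_of_abs_le (u := r) (v := r) hfx,
    two_mul_mul_le_of_abs_le (u := φ) (v := φ) hgx,
    two_mul_mul_le_of_abs_le (u := φ) (v := -δ) hgxx,
    two_mul_mul_le_of_abs_le (u := r) (v := -δ) hσx,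
    two_mul_mul_le_of_abs_le (u := r) (v := φ) hσ, sq_nonneg (φ + r)]

variable (F : IsClassicalSolution f₀ ρ₀ T f ρ) (G : IsClassicalSolution f₀ ρ₀ T g σ)
include F G

theorem continuousOn_energyDensity :
    ContinuousOn (uncurry (energyDensity f ρ g σ)) (Ico 0 T ×ˢ Icc 0 1) :=
  ((F.continuous_fx.sub G.continuous_fx).pow 2).add
    ((F.continuous_rho.sub G.continuous_rho).pow 2)

theorem continuousOn_energyDensityRate :
    ContinuousOn (uncurry (energyDensityRate f ρ g σ)) (Ico 0 T ×ˢ Icc 0 1) := by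
  have nonlocal_F : ContinuousOn (fun p : ℝ × ℝ => nonlocalTerm f ρ p.1) (Ico 0 T ×ˢ Icc 0 1) :=
    F.continuousOn_nonlocalTerm.comp continuousOn_fst fun _ hp => hp.1
  have nonlocal_G : ContinuousOn (fun p : ℝ × ℝ => nonlocalTerm g σ p.1) (Ico 0 T ×ˢ Icc 0 1) :=
    G.continuousOn_nonlocalTerm.comp continuousOn_fst fun _ hp => hp.1
  obtain ⟨-, -, F₀, F₁, F₂, R₀, R₁, -⟩ := F
  obtain ⟨-, -, G₀, G₁, G₂, S₀, S₁, -⟩ := G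
  unfold energyDensityRate uncurry
  fun_prop

theorem continuousOn_energySource :
    ContinuousOn (uncurry (energySource f ρ g σ)) (Ico 0 T ×ˢ Icc 0 1) := by
  obtain ⟨-, -, F₀, F₁, -, R₀, -⟩ := F
  obtain ⟨-, -, G₀, G₁, G₂, S₀, S₁, -⟩ := G
  unfold energySource uncurry
  fun_prop

theorem intervalIntegrable_energyDensity (ht : t ∈ Ico 0 T) :
    IntervalIntegrable (energyDensity f ρ g σ t) volume 0 1 :=
  (continuousOn_slice (continuousOn_energyDensity F G) ht).intervalIntegrable_of_Icc zero_le_one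

theorem sq_sub_le_energy (ht : t ∈ Ico 0 T) (hx : x ∈ Icc (0 : ℝ) 1) :
    (f t x - g t x) ^ 2 ≤ energy f ρ g σ t := by
  have cont_fx := continuousOn_dx ((F.contDiff_f t ht).of_le one_le_two)
  have cont_gx := continuousOn_dx ((G.contDiff_f t ht).of_le one_le_two)
  have hsub : Icc 0 x ⊆ Icc (0 : ℝ) 1 := Icc_subset_Icc_right hx.2
  have cont_sq : ContinuousOn (fun y => (dx (f t) y - dx (g t) y) ^ 2) (Icc 0 1) :=
    (cont_fx.sub cont_gx).pow 2
  calc (f t x - g t x) ^ 2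
      = (∫ y in (0 : ℝ)..x, (dx (f t) y - dx (g t) y)) ^ 2 := by
        rw [intervalIntegral.integral_sub
          ((cont_fx.mono hsub).intervalIntegrable_of_Icc hx.1)
          ((cont_gx.mono hsub).intervalIntegrable_of_Icc hx.1),
          F.integral_fx ht hx, G.integral_fx ht hx]
    _ ≤ (x - 0) * ∫ y in (0 : ℝ)..x, (dx (f t) y - dx (g t) y) ^ 2 :=
        sq_integral_le hx.1 ((cont_fx.sub cont_gx).mono hsub)
    _ ≤ ∫ y in (0 : ℝ)..x, (dx (f t) y - dx (g t) y) ^ 2 :=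
        mul_le_of_le_one_left (intervalIntegral.integral_nonneg hx.1 fun _ _ => sq_nonneg _)
          (by linarith [hx.2])
    _ ≤ ∫ y in (0 : ℝ)..1, (dx (f t) y - dx (g t) y) ^ 2 :=
        intervalIntegral.integral_mono_interval le_rfl hx.1 hx.2
          (Eventually.of_forall fun _ => sq_nonneg _)
          (cont_sq.intervalIntegrable_of_Icc zero_le_one)
    _ ≤ energy f ρ g σ t :=
        intervalIntegral.integral_mono_on zero_le_one
          (cont_sq.intervalIntegrable_of_Icc zero_le_one)
          (intervalIntegrable_energyDensity F G ht) fun _ _ => le_add_of_nonneg_right (sq_nonneg _)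

theorem hasDerivAt_energyDensity (ht : t ∈ Ioo 0 T) (hx : x ∈ Icc (0 : ℝ) 1) :
    HasDerivAt (fun s => energyDensity f ρ g σ s x) (energyDensityRate f ρ g σ t x) t := by
  refine ((((F.hasDerivAt_fx_time ht hx).sub (G.hasDerivAt_fx_time ht hx)).pow 2).add
    (((F.hasDerivAt_rho_time ht hx).sub (G.hasDerivAt_rho_time ht hx)).pow 2)).congr_deriv ?_
  simp only [energyDensityRate, Pi.sub_apply]
  push_cast
  ring

theorem hasDerivWithinAt_energyFlux (ht : t ∈ Ico 0 T) (hx : x ∈ Icc (0 : ℝ) 1) :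
    HasDerivWithinAt (energyFlux f ρ g σ t)
      (energyDensityRate f ρ g σ t x - energySource f ρ g σ t x) (Icc 0 1) x := by
  have deriv_f := F.hasDerivWithinAt_f ht hx
  have deriv_density :=
    (((F.hasDerivWithinAt_fx ht hx).sub (G.hasDerivWithinAt_fx ht hx)).pow 2).add
      (((F.hasDerivWithinAt_rho ht hx).sub (G.hasDerivWithinAt_rho ht hx)).pow 2)
  refine (((deriv_f.sub (G.hasDerivWithinAt_f ht hx)).const_mul
    (2 * (nonlocalTerm f ρ t - nonlocalTerm g σ t))).sub
      (deriv_f.mul deriv_density)).congr_deriv ?_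
  simp only [energyDensityRate, energySource, Pi.sub_apply, Pi.add_apply, Pi.pow_apply]
  push_cast
  ring

theorem integral_energyDensityRate (ht : t ∈ Ico 0 T) :
    ∫ x in (0 : ℝ)..1, energyDensityRate f ρ g σ t x
      = ∫ x in (0 : ℝ)..1, energySource f ρ g σ t x := by
  have int_rate := (continuousOn_slice (continuousOn_energyDensityRate F G)
    ht).intervalIntegrable_of_Icc (μ := volume) zero_le_one
  have int_source := (continuousOn_slice (continuousOn_energySource F G)
    ht).intervalIntegrable_of_Icc (μ := volume) zero_le_one
  rw [← sub_eq_zero, ← intervalIntegral.integral_sub int_rate int_source,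
    intervalIntegral.integral_eq_sub_of_hasDerivAt_of_le (f := energyFlux f ρ g σ t) zero_le_one
      (fun x hx => (hasDerivWithinAt_energyFlux F G ht hx).continuousWithinAt)
      (fun x hx => (hasDerivWithinAt_energyFlux F G ht (Ioo_subset_Icc_self hx)).hasDerivAt
        (Icc_mem_nhds hx.1 hx.2)) (int_rate.sub int_source)]
  simp [energyFlux, F.boundary_f t ht, G.boundary_f t ht]

theorem hasDerivAt_energy (ht : t ∈ Ioo 0 T) :
    HasDerivAt (energy f ρ g σ) (∫ x in (0 : ℝ)..1, energySource f ρ g σ t x) t := by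
  rw [← integral_energyDensityRate F G (Ioo_subset_Ico_self ht)]
  exact hasDerivAt_parametric_integral isOpen_Ioo zero_le_one
    (fun s hs => continuousOn_slice (continuousOn_energyDensity F G) (Ioo_subset_Ico_self hs))
    ((continuousOn_energyDensityRate F G).mono (prod_mono_left Ioo_subset_Ico_self))
    (fun s hs y hy => hasDerivAt_energyDensity F G hs hy) ht

theorem exists_uniform_bound (ht : t ∈ Ico 0 T) :
    ∃ C, ∀ s ∈ Icc 0 t, ∀ x ∈ Icc (0 : ℝ) 1, |dx (f s) x| ≤ C ∧ |dx (g s) x| ≤ C ∧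
      |dx (dx (g s)) x| ≤ C ∧ |σ s x| ≤ C ∧ |dx (σ s) x| ≤ C := by
  obtain ⟨C, hC⟩ := (isCompact_Icc.prod isCompact_Icc).exists_bound_of_continuousOn
    ((F.continuous_fx.prodMk (G.continuous_fx.prodMk (G.continuous_fxx.prodMk
      (G.continuous_rho.prodMk G.continuous_rhox)))).mono
        (prod_mono_left (Icc_subset_Ico_right ht.2)))
  exact ⟨C, fun s hs x hx => by
    simpa only [norm_prod_le_iff, Real.norm_eq_abs] using hC (s, x) ⟨hs, hx⟩⟩

theorem energy_init : energy f ρ g σ 0 = 0 := by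
  have density_zero : EqOn (energyDensity f ρ g σ 0) (fun _ => 0) (uIcc 0 1) := fun x hx => by
    rw [uIcc_of_le zero_le_one] at hx
    have initial_fx : dx (f 0) x = dx (g 0) x :=
      dx_congr (fun y hy => (F.initial_f y hy).trans (G.initial_f y hy).symm) hx
    simp [energyDensity, initial_fx, F.initial_rho x hx, G.initial_rho x hx]
  rw [energy, intervalIntegral.integral_congr density_zero, intervalIntegral.integral_zero]

theorem energy_eq_zero (ht : t ∈ Ico 0 T) : energy f ρ g σ t = 0 := by
  have hsub : Icc 0 t ⊆ Ico 0 T := Icc_subset_Ico_right ht.2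
  obtain ⟨C, hC⟩ := exists_uniform_bound F G ht
  refine eq_zero_of_hasDerivAt_le_mul (K := 10 * C + 1) (energy_init F G) energy_nonneg
    ((continuousOn_parametric_integral zero_le_one (continuousOn_energyDensity F G)).mono hsub)
    (fun s hs => hasDerivAt_energy F G ⟨hs.1, hs.2.trans ht.2⟩) (fun s hs => ?_)
    (right_mem_Icc.2 ht.1)
  have hsI : s ∈ Icc 0 t := Ioo_subset_Icc_self hs
  have int_source : IntervalIntegrable (energySource f ρ g σ s) volume 0 1 :=
    (continuousOn_slice (continuousOn_energySource F G)
      (hsub hsI)).intervalIntegrable_of_Icc zero_le_one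
  have int_density := (intervalIntegrable_energyDensity F G (hsub hsI)).const_mul (8 * C + 1)
  calc ∫ x in (0 : ℝ)..1, energySource f ρ g σ s x
      ≤ ∫ x in (0 : ℝ)..1,
          ((8 * C + 1) * energyDensity f ρ g σ s x + 2 * C * energy f ρ g σ s) := by
        refine intervalIntegral.integral_mono_on zero_le_one int_source
          (int_density.add intervalIntegrable_const) fun x hx => ?_
        obtain ⟨hfx, hgx, hgxx, hσ, hσx⟩ := hC s hsI x hx
        exact energySource_le hfx hgx hgxx hσ hσx (sq_sub_le_energy F G (hsub hsI) hx)
    _ = (10 * C + 1) * energy f ρ g σ s := by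
        rw [intervalIntegral.integral_add int_density intervalIntegrable_const,
          intervalIntegral.integral_const_mul, intervalIntegral.integral_const, ← energy,
          sub_zero, one_smul]
        ring

theorem unique (ht : t ∈ Ico 0 T) (hx : x ∈ Icc (0 : ℝ) 1) : f t x = g t x ∧ ρ t x = σ t x := by
  have hE := energy_eq_zero F G ht
  constructor
  · have hsq := sq_sub_le_energy F G ht hx
    rw [hE] at hsq
    exact sub_eq_zero.1 (pow_eq_zero_iff two_ne_zero |>.1 (le_antisymm hsq (sq_nonneg _)))
  · by_contra hne
    have hpos : 0 < energy f ρ g σ t :=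
      intervalIntegral.integral_pos zero_lt_one
        (continuousOn_slice (continuousOn_energyDensity F G) ht)
        (fun _ _ => add_nonneg (sq_nonneg _) (sq_nonneg _))
        ⟨x, hx, add_pos_of_nonneg_of_pos (sq_nonneg _) (sq_pos_of_ne_zero (sub_ne_zero.2 hne))⟩
    exact hpos.ne' hE

end Energy

theorem lifespan_le {T₁ : ℝ} (F : IsClassicalSolution f₀ ρ₀ T₁ f ρ)
    (G : IsClassicalSolution f₀ ρ₀ T g σ) (hT₁ : 0 < T₁) (hx : x ∈ Icc (0 : ℝ) 1)
    (h : Tendsto (fun t => ∫ s in (0 : ℝ)..t, dx (f s) x) (𝓝[<] T₁) atTop) : T ≤ T₁ := by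
  by_contra! hlt
  have cont_gx : ContinuousOn (fun s => dx (g s) x) (Icc 0 T₁) :=
    G.continuous_fx.comp (f := fun s => (s, x)) (by fun_prop)
      fun s hs => ⟨⟨hs.1, hs.2.trans_lt hlt⟩, hx⟩
  obtain ⟨B, hB⟩ := isCompact_Icc.exists_bound_of_continuousOn cont_gx
  have hB_nonneg : 0 ≤ B := (norm_nonneg _).trans (hB 0 ⟨le_rfl, hT₁.le⟩)
  obtain ⟨t, hgt, ht⟩ := ((h.eventually_gt_atTop (B * T₁)).and (Ioo_mem_nhdsLT hT₁)).exists
  have norm_le := intervalIntegral.norm_integral_le_of_norm_le_const (a := 0) (b := t) (C := B)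
    (f := fun s => dx (f s) x) fun s hs => by
      rw [uIoc_of_le ht.1.le] at hs
      have hs' : s ∈ Ico 0 T₁ := ⟨hs.1.le, hs.2.trans_lt ht.2⟩
      rw [dx_congr (fun y hy => (F.unique (G.mono hlt.le) hs' hy).1) hx]
      exact hB s (Ico_subset_Icc_self hs')
  refine hgt.not_ge ((Real.le_norm_self _).trans (norm_le.trans ?_))
  rw [sub_zero, abs_of_pos ht.1]
  exact mul_le_mul_of_nonneg_left ht.2.le hB_nonneg

end IsClassicalSolution

/-- The first-order system equivalent to `g'' = Ψ(s, g)`. -/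
def phaseField (Ψ : ℝ → ℝ → ℝ) (s : ℝ) (p : ℝ × ℝ) : ℝ × ℝ := (p.2, Ψ s p.1)

/-- The first-order system satisfied by `(g, T g')` when `g'' = Ψ(s, g)`. The scaling makes the
radius condition of the Picard–Lindelöf theorem hold on every interval of length at most `T`. -/
def scaledPhaseField (T : ℝ≥0) (Ψ : ℝ → ℝ → ℝ) (s : ℝ) (p : ℝ × ℝ) : ℝ × ℝ :=
  ((T : ℝ)⁻¹ * p.2, T * Ψ s p.1)

theorem lipschitzWith_phaseField {Ψ : ℝ → ℝ → ℝ} {s : ℝ} {K : ℝ≥0} (h : LipschitzWith K (Ψ s)) :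
    LipschitzWith (max 1 K) (phaseField Ψ s) :=
  LipschitzWith.prod_snd.prodMk (mul_one K ▸ h.comp LipschitzWith.prod_fst)

theorem lipschitzWith_scaledPhaseField {Ψ : ℝ → ℝ → ℝ} {s : ℝ} {K : ℝ≥0} (T : ℝ≥0)
    (h : LipschitzWith K (Ψ s)) :
    LipschitzWith (max T⁻¹ (T * K)) (scaledPhaseField T Ψ s) := by
  have lip_fst := (lipschitzWith_smul (T : ℝ)⁻¹).comp (LipschitzWith.prod_snd (α := ℝ) (β := ℝ))
  have lip_snd := (lipschitzWith_smul (T : ℝ)).comp (h.comp (LipschitzWith.prod_fst (β := ℝ)))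
  simp only [nnnorm_inv, NNReal.nnnorm_eq, mul_one] at lip_fst lip_snd
  exact lip_fst.prodMk lip_snd

theorem isPicardLindelof_scaledPhaseField {a b : ℝ} (ha : a < 0) (hb : 0 < b) {Ψ : ℝ → ℝ → ℝ}
    {C K T : ℝ≥0} (hT : b - a ≤ T) (hcont : ∀ y, ContinuousOn (fun s => Ψ s y) (Icc a b))
    (hbd : ∀ s ∈ Icc a b, ∀ y, |Ψ s y| ≤ C) (hlip : ∀ s ∈ Icc a b, LipschitzWith K (Ψ s)) :
    IsPicardLindelof (scaledPhaseField T Ψ) (tmin := a) (tmax := b) ⟨0, ha.le, hb.le⟩ 0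
      (C * T ^ 2) 0 (C * T) (max T⁻¹ (T * K)) where
  lipschitzOnWith s hs := (lipschitzWith_scaledPhaseField T (hlip s hs)).lipschitzOnWith
  continuousOn p _ := continuousOn_const.prodMk ((hcont p.1).const_mul _)
  norm_le s hs p hp := by
    have hT0 : 0 < (T : ℝ) := by linarith
    have norm_snd : ‖p.2‖ ≤ C * T ^ 2 :=
      (norm_snd_le p).trans (by exact_mod_cast mem_closedBall_zero_iff.1 hp)
    refine max_le ?_ ?_
    · change ‖(T : ℝ)⁻¹ * p.2‖ ≤ C * T
      rw [norm_mul, norm_inv, Real.norm_of_nonneg hT0.le, inv_mul_le_iff₀ hT0]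
      linarith
    · change ‖(T : ℝ) * Ψ s p.1‖ ≤ C * T
      rw [norm_mul, Real.norm_of_nonneg hT0.le, mul_comm]
      exact mul_le_mul_of_nonneg_right (hbd s hs _) hT0.le
  mul_max_le := by
    have hmax : max (b - 0) (0 - a) ≤ T := max_le (by linarith) (by linarith)
    push_cast
    calc (C : ℝ) * T * max (b - 0) (0 - a) ≤ C * T * T := by gcongr
      _ = C * T ^ 2 - 0 := by ring

theorem exists_hasDerivAt_phaseField {a b : ℝ} (ha : a < 0) (hb : 0 < b) {Ψ : ℝ → ℝ → ℝ}
    (hcont : ∀ y, ContinuousOn (fun s => Ψ s y) (Icc a b)) {C K : ℝ≥0}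
    (hbd : ∀ s ∈ Icc a b, ∀ y, |Ψ s y| ≤ C) (hlip : ∀ s ∈ Icc a b, LipschitzWith K (Ψ s)) :
    ∃ p : ℝ → ℝ × ℝ, p 0 = 0 ∧ ∀ s ∈ Ioo a b, HasDerivAt p (phaseField Ψ s (p s)) s := by
  lift b - a to ℝ≥0 using by linarith with T hT
  have hT0 : (T : ℝ) ≠ 0 := by linarith
  obtain ⟨q, hq0, hq⟩ := (isPicardLindelof_scaledPhaseField ha hb hT.ge hcont hbd
    hlip).exists_eq_forall_mem_Icc_hasDerivWithinAt₀
  refine ⟨fun s => ((q s).1, (T : ℝ)⁻¹ * (q s).2), ?_, fun s hs => ?_⟩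
  · change q 0 = 0 at hq0
    simp [hq0]
  · have deriv_q := (hq s (Ioo_subset_Icc_self hs)).hasDerivAt (Icc_mem_nhds hs.1 hs.2)
    have deriv_fst := (hasFDerivAt_fst (𝕜 := ℝ) (p := q s)).comp_hasDerivAt s deriv_q
    have deriv_snd := (hasFDerivAt_snd (𝕜 := ℝ) (p := q s)).comp_hasDerivAt s deriv_q
    refine (deriv_fst.prodMk (deriv_snd.const_mul (T : ℝ)⁻¹)).congr_deriv ?_
    simp only [phaseField, scaledPhaseField, ContinuousLinearMap.coe_fst',
      ContinuousLinearMap.coe_snd', inv_mul_cancel_left₀ hT0]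

theorem exists_mem_Ioo_mul {a b s : ℝ} (ha : a < 0) (hb : 0 < b) (hs : s ∈ Ioo a b) :
    ∃ θ ∈ Ioo (0 : ℝ) 1, s ∈ Ioo (θ * a) (θ * b) := by
  obtain ⟨θ, hlt, hθ⟩ := exists_between (show max 0 (max (s / a) (s / b)) < 1 from
    max_lt one_pos (max_lt ((div_lt_one_of_neg ha).2 hs.1) ((div_lt_one hb).2 hs.2)))
  obtain ⟨hθ0, hlt⟩ := max_lt_iff.1 hlt
  obtain ⟨hsa, hsb⟩ := max_lt_iff.1 hlt
  exact ⟨θ, ⟨hθ0, hθ⟩, (div_lt_iff_of_neg ha).1 hsa, (div_lt_iff₀ hb).1 hsb⟩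

theorem exists_hasDerivAt_of_exhaustion {E : Type*} [NormedAddCommGroup E] [NormedSpace ℝ E]
    {a b : ℝ} (ha : a < 0) (hb : 0 < b) {v : ℝ → E → E} {x₀ : E}
    (hlip : ∀ θ ∈ Ioo (0 : ℝ) 1, ∃ K : ℝ≥0, ∀ s ∈ Ioo (θ * a) (θ * b), LipschitzWith K (v s))
    (hex : ∀ θ ∈ Ioo (0 : ℝ) 1,
      ∃ p : ℝ → E, p 0 = x₀ ∧ ∀ s ∈ Ioo (θ * a) (θ * b), HasDerivAt p (v s (p s)) s) :
    ∃ p : ℝ → E, p 0 = x₀ ∧ ∀ s ∈ Ioo a b, HasDerivAt p (v s (p s)) s := by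
  choose! p hp₀ hp using hex
  have agree_of_le : ∀ θ ∈ Ioo (0 : ℝ) 1, ∀ θ' ∈ Ioo (0 : ℝ) 1, θ ≤ θ' →
      EqOn (p θ) (p θ') (Ioo (θ * a) (θ * b)) := fun θ hθ θ' hθ' hle => by
    have hsub : Ioo (θ * a) (θ * b) ⊆ Ioo (θ' * a) (θ' * b) := Ioo_subset_Ioo
      (mul_le_mul_of_nonpos_right hle ha.le) (mul_le_mul_of_nonneg_right hle hb.le)
    obtain ⟨K, hK⟩ := hlip θ hθ
    exact ODE_solution_unique_of_mem_Ioo (s := fun _ => univ) (K := K)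
      (fun s hs => (hK s hs).lipschitzOnWith)
      ⟨mul_neg_of_pos_of_neg hθ.1 ha, mul_pos hθ.1 hb⟩
      (fun s hs => ⟨hp θ hθ s hs, mem_univ _⟩) (fun s hs => ⟨hp θ' hθ' s (hsub hs), mem_univ _⟩)
      ((hp₀ θ hθ).trans (hp₀ θ' hθ').symm)
  have agree : ∀ θ ∈ Ioo (0 : ℝ) 1, ∀ θ' ∈ Ioo (0 : ℝ) 1, ∀ s ∈ Ioo (θ * a) (θ * b),
      s ∈ Ioo (θ' * a) (θ' * b) → p θ s = p θ' s := fun θ hθ θ' hθ' s hs hs' =>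
    (le_total θ θ').elim (fun hle => agree_of_le θ hθ θ' hθ' hle hs)
      fun hle => (agree_of_le θ' hθ' θ hθ hle hs').symm
  choose! θ hθ hmem using fun s (hs : s ∈ Ioo a b) => exists_mem_Ioo_mul ha hb hs
  refine ⟨fun s => p (θ s) s, hp₀ _ (hθ 0 ⟨ha, hb⟩), fun s hs => ?_⟩
  refine (hp (θ s) (hθ s hs) s (hmem s hs)).congr_of_eventuallyEq ?_
  filter_upwards [isOpen_Ioo.mem_nhds hs, isOpen_Ioo.mem_nhds (hmem s hs)] with s' hs' hmem'
  exact agree _ (hθ s' hs') _ (hθ s hs) s' (hmem s' hs') hmem'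

theorem exists_second_order_ode {a b : ℝ} (ha : a < 0) (hb : 0 < b) {Ψ : ℝ → ℝ → ℝ}
    (hcont : ∀ y, ContinuousOn (fun s => Ψ s y) (Ioo a b))
    (hbd : ∀ a' b', a < a' → b' < b → ∃ C : ℝ≥0, ∀ s ∈ Icc a' b', ∀ y, |Ψ s y| ≤ C)
    (hlip : ∀ a' b', a < a' → b' < b → ∃ K : ℝ≥0, ∀ s ∈ Icc a' b', LipschitzWith K (Ψ s)) :
    ∃ g k : ℝ → ℝ, g 0 = 0 ∧ k 0 = 0 ∧
      (∀ s ∈ Ioo a b, HasDerivAt g (k s) s) ∧ ∀ s ∈ Ioo a b, HasDerivAt k (Ψ s (g s)) s := by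
  have lt_mul : ∀ θ ∈ Ioo (0 : ℝ) 1, a < θ * a := fun θ hθ => lt_mul_of_lt_one_left ha hθ.2
  have mul_lt : ∀ θ ∈ Ioo (0 : ℝ) 1, θ * b < b := fun θ hθ => mul_lt_of_lt_one_left hb hθ.2
  obtain ⟨p, hp₀, hp⟩ := exists_hasDerivAt_of_exhaustion ha hb (v := phaseField Ψ) (x₀ := 0)
    (fun θ hθ => by
      obtain ⟨K, hK⟩ := hlip _ _ (lt_mul θ hθ) (mul_lt θ hθ)
      exact ⟨max 1 K, fun s hs => lipschitzWith_phaseField (hK s (Ioo_subset_Icc_self hs))⟩)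
    fun θ hθ => by
      obtain ⟨C, hC⟩ := hbd _ _ (lt_mul θ hθ) (mul_lt θ hθ)
      obtain ⟨K, hK⟩ := hlip _ _ (lt_mul θ hθ) (mul_lt θ hθ)
      exact exists_hasDerivAt_phaseField (mul_neg_of_pos_of_neg hθ.1 ha) (mul_pos hθ.1 hb)
        (fun y => (hcont y).mono (Icc_subset_Ioo (lt_mul θ hθ) (mul_lt θ hθ))) hC hK
  exact ⟨fun s => (p s).1, fun s => (p s).2, congrArg Prod.fst hp₀, congrArg Prod.snd hp₀,
    fun s hs => (hasFDerivAt_fst (𝕜 := ℝ) (p := p s)).comp_hasDerivAt s (hp s hs),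
    fun s hs => (hasFDerivAt_snd (𝕜 := ℝ) (p := p s)).comp_hasDerivAt s (hp s hs)⟩

/-- The data of the problem, extended to all of `ℝ`: `h` stands for `f₀'` and `r` for `ρ₀`, with
derivatives `h'` and `r'` on `[0, 1]`. The bounds `M` and `H` determine the interval
`(-1/H, 1/M)` of stretched time. -/
structure Profile where
  (h h' r r' : ℝ → ℝ)
  (M H : ℝ)
  continuous_h : Continuous h
  continuous_r : Continuous r
  M_pos : 0 < M
  H_pos : 0 < H
  h_le : ∀ x, h x ≤ M
  abs_h_le : ∀ x, |h x| ≤ H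
  r_nonneg : ∀ x, 0 ≤ r x
  r_le : ∀ x, r x ≤ H
  deriv_h : ∀ x ∈ Icc (0 : ℝ) 1, HasDerivWithinAt h (h' x) (Icc 0 1) x
  continuousOn_h' : ContinuousOn h' (Icc 0 1)
  deriv_r : ∀ x ∈ Icc (0 : ℝ) 1, HasDerivWithinAt r (r' x) (Icc 0 1) x
  continuousOn_r' : ContinuousOn r' (Icc 0 1)
  r_zero : r 0 = 0
  r_one : r 1 = 0
  integral_h : ∫ x in (0 : ℝ)..1, h x = 0

namespace Profile

variable (P : Profile) {η y z m : ℝ}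

/-- The range of the stretched time `η`. -/
abbrev domain : Set ℝ := Ioo (-P.H⁻¹) P.M⁻¹

/-- The reciprocal Jacobian at stretched time `η`, up to normalisation, when the amplitude of the
temperature is `y`. -/
def denom (η y x : ℝ) : ℝ := 1 - P.h x * η + P.r x * y

/-- The normalising factor that gives the Jacobian mean one. -/
def meanInv (η y : ℝ) : ℝ := ∫ x in (0 : ℝ)..1, (P.denom η y x)⁻¹

/-- The right-hand side of the amplitude equation `g'' = amplitudeRate(η, g)`. Its dependence on
the amplitude `y` is truncated at `y = 0` so that it is Lipschitz; solutions stay nonnegative. -/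
def amplitudeRate (η y : ℝ) : ℝ := P.meanInv η (max y 0) ^ 3

theorem continuous_denom (η y : ℝ) : Continuous (P.denom η y) := by
  have := P.continuous_h
  have := P.continuous_r
  unfold denom
  fun_prop

theorem exists_pos_le_denom {a b : ℝ} (ha : -P.H⁻¹ < a) (hb : b < P.M⁻¹) :
    ∃ m > 0, ∀ η ∈ Icc a b, ∀ y, 0 ≤ y → ∀ x, m ≤ P.denom η y x := by
  refine ⟨min (1 + P.H * a) (1 - P.M * b), lt_min ?_ ?_, fun η hη y hy x => ?_⟩
  · have := (div_lt_iff₀' P.H_pos).1 (show -1 / P.H < a by rwa [neg_div, one_div])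
    linarith
  · have := (lt_div_iff₀' P.M_pos).1 (show b < 1 / P.M by rwa [one_div])
    linarith
  · have hry := mul_nonneg (P.r_nonneg x) hy
    unfold denom
    rcases le_total 0 η with hη₀ | hη₀
    · have h_mul_le : P.h x * η ≤ P.M * b :=
        (mul_le_mul_of_nonneg_right (P.h_le x) hη₀).trans
          (mul_le_mul_of_nonneg_left hη.2 P.M_pos.le)
      linarith [min_le_right (1 + P.H * a) (1 - P.M * b)]
    · have h_mul_le : P.h x * η ≤ -P.H * a :=
        (mul_le_mul_of_nonpos_right (neg_le_of_abs_le (P.abs_h_le x)) hη₀).trans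
          (mul_le_mul_of_nonpos_left hη.1 (neg_nonpos.2 P.H_pos.le))
      linarith [min_le_left (1 + P.H * a) (1 - P.M * b)]

theorem denom_pos (hη : η ∈ P.domain) (hy : 0 ≤ y) (x : ℝ) : 0 < P.denom η y x := by
  obtain ⟨m, hm, hle⟩ := P.exists_pos_le_denom hη.1 hη.2
  exact hm.trans_le (hle η ⟨le_rfl, le_rfl⟩ y hy x)

theorem meanInv_nonneg (hη : η ∈ P.domain) (hy : 0 ≤ y) : 0 ≤ P.meanInv η y :=
  intervalIntegral.integral_nonneg zero_le_one fun x _ => (inv_pos.2 (P.denom_pos hη hy x)).le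

theorem abs_meanInv_le (hm : 0 < m) (hle : ∀ x, m ≤ P.denom η y x) :
    |P.meanInv η y| ≤ m⁻¹ := by
  have := intervalIntegral.norm_integral_le_of_norm_le_const (a := 0) (b := 1) (C := m⁻¹)
    (f := fun x => (P.denom η y x)⁻¹) fun x _ => by
      rw [norm_inv, Real.norm_of_nonneg (hm.le.trans (hle x))]
      exact inv_anti₀ hm (hle x)
  simpa [meanInv] using this

theorem abs_inv_denom_sub_le (hm : 0 < m) {x : ℝ} (hy : m ≤ P.denom η y x)
    (hz : m ≤ P.denom η z x) :
    |(P.denom η y x)⁻¹ - (P.denom η z x)⁻¹| ≤ P.H * m⁻¹ ^ 2 * |y - z| := by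
  have hy₀ := hm.trans_le hy
  have hz₀ := hm.trans_le hz
  have denom_sub : P.denom η z x - P.denom η y x = P.r x * (z - y) := by unfold denom; ring
  rw [inv_sub_inv hy₀.ne' hz₀.ne', abs_div, abs_of_pos (mul_pos hy₀ hz₀), denom_sub, abs_mul,
    abs_of_nonneg (P.r_nonneg x), abs_sub_comm z y]
  calc P.r x * |y - z| / (P.denom η y x * P.denom η z x)
      ≤ P.H * |y - z| / (m * m) := by
        have := P.H_pos
        gcongr
        exact P.r_le x
    _ = P.H * m⁻¹ ^ 2 * |y - z| := by field_simp

theorem abs_meanInv_sub_le (hm : 0 < m) (hy : ∀ x, m ≤ P.denom η y x)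
    (hz : ∀ x, m ≤ P.denom η z x) :
    |P.meanInv η y - P.meanInv η z| ≤ P.H * m⁻¹ ^ 2 * |y - z| := by
  have intervalIntegrable_inv : ∀ {y}, (∀ x, m ≤ P.denom η y x) →
      IntervalIntegrable (fun x => (P.denom η y x)⁻¹) volume 0 1 := fun {y} h =>
    ((P.continuous_denom η y).inv₀ fun x => (hm.trans_le (h x)).ne').intervalIntegrable _ _
  have := intervalIntegral.norm_integral_le_of_norm_le_const (a := 0) (b := 1)
    (C := P.H * m⁻¹ ^ 2 * |y - z|) (f := fun x => (P.denom η y x)⁻¹ - (P.denom η z x)⁻¹)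
    fun x _ => P.abs_inv_denom_sub_le hm (hy x) (hz x)
  rw [intervalIntegral.integral_sub (intervalIntegrable_inv hy) (intervalIntegrable_inv hz)] at this
  simpa only [meanInv, Real.norm_eq_abs, sub_zero, abs_one, mul_one] using this

theorem continuousOn_amplitudeRate (y : ℝ) :
    ContinuousOn (fun η => P.amplitudeRate η y) P.domain := by
  have := P.continuous_h
  have := P.continuous_r
  refine (continuousOn_parametric_integral (F := fun η x => (P.denom η (max y 0) x)⁻¹)
    zero_le_one (ContinuousOn.inv₀ ?_ fun p hp => ?_)).pow 3
  · unfold denom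
    fun_prop
  · exact (P.denom_pos hp.1 (le_max_right _ _) _).ne'

theorem exists_abs_amplitudeRate_le {a b : ℝ} (ha : -P.H⁻¹ < a) (hb : b < P.M⁻¹) :
    ∃ C : ℝ≥0, ∀ η ∈ Icc a b, ∀ y, |P.amplitudeRate η y| ≤ C := by
  obtain ⟨m, hm, hle⟩ := P.exists_pos_le_denom ha hb
  refine ⟨⟨m⁻¹ ^ 3, by positivity⟩, fun η hη y => ?_⟩
  rw [amplitudeRate, abs_pow]
  exact pow_le_pow_left₀ (abs_nonneg _) (P.abs_meanInv_le hm (hle η hη _ (le_max_right _ _))) 3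

theorem exists_lipschitzWith_amplitudeRate {a b : ℝ} (ha : -P.H⁻¹ < a) (hb : b < P.M⁻¹) :
    ∃ K : ℝ≥0, ∀ η ∈ Icc a b, LipschitzWith K (P.amplitudeRate η) := by
  obtain ⟨m, hm, hle⟩ := P.exists_pos_le_denom ha hb
  have hH := P.H_pos
  refine ⟨⟨P.H * m⁻¹ ^ 2 * 3 * m⁻¹ ^ 2, by positivity⟩, fun η hη =>
    LipschitzWith.of_dist_le_mul fun y z => ?_⟩
  have hy := hle η hη _ (le_max_right y 0)
  have hz := hle η hη _ (le_max_right z 0)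
  rw [Real.dist_eq, Real.dist_eq]
  calc |P.meanInv η (max y 0) ^ 3 - P.meanInv η (max z 0) ^ 3|
      ≤ |P.meanInv η (max y 0) - P.meanInv η (max z 0)| * (3 : ℕ)
          * max |P.meanInv η (max y 0)| |P.meanInv η (max z 0)| ^ (3 - 1) :=
        abs_pow_sub_pow_le _ _ _
    _ ≤ P.H * m⁻¹ ^ 2 * |y - z| * (3 : ℕ) * m⁻¹ ^ (3 - 1) := by
        gcongr
        · exact (P.abs_meanInv_sub_le hm hy hz).trans
            (mul_le_mul_of_nonneg_left (abs_max_sub_max_le_abs y z 0) (by positivity))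
        · exact max_le (P.abs_meanInv_le hm hy) (P.abs_meanInv_le hm hz)
    _ = P.H * m⁻¹ ^ 2 * 3 * m⁻¹ ^ 2 * |y - z| := by push_cast; ring

theorem zero_mem_domain : (0 : ℝ) ∈ P.domain :=
  ⟨neg_lt_zero.2 (inv_pos.2 P.H_pos), inv_pos.2 P.M_pos⟩

end Profile

/-- The solution of the amplitude equation `g'' = meanInv³`, `g(0) = g'(0) = 0`, on the whole
range of stretched time; `k` is the derivative of `g`. -/
structure Amplitude (P : Profile) where
  (g k : ℝ → ℝ)
  g_zero : g 0 = 0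
  k_zero : k 0 = 0
  g_nonneg : ∀ η ∈ P.domain, 0 ≤ g η
  k_nonneg : ∀ η ∈ P.domain, 0 ≤ η → 0 ≤ k η
  deriv_g : ∀ η ∈ P.domain, HasDerivAt g (k η) η
  deriv_k : ∀ η ∈ P.domain, HasDerivAt k (P.meanInv η (g η) ^ 3) η

theorem monotoneOn_of_hasDerivAt_nonneg {k k' : ℝ → ℝ} {a b : ℝ}
    (hk : ∀ s ∈ Ioo a b, HasDerivAt k (k' s) s) (hk' : ∀ s ∈ Ioo a b, 0 ≤ k' s) :
    MonotoneOn k (Ioo a b) :=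
  monotoneOn_of_hasDerivWithinAt_nonneg (convex_Ioo a b)
    (fun s hs => (hk s hs).continuousAt.continuousWithinAt)
    (fun s hs => (hk s (interior_subset hs)).hasDerivWithinAt)
    fun s hs => hk' s (interior_subset hs)

theorem nonneg_of_monotoneOn_hasDerivAt {a b : ℝ} {g k : ℝ → ℝ} (h0 : (0 : ℝ) ∈ Ioo a b)
    (hg₀ : g 0 = 0) (hk₀ : k 0 = 0) (hg : ∀ s ∈ Ioo a b, HasDerivAt g (k s) s)
    (hk : MonotoneOn k (Ioo a b)) {s : ℝ} (hs : s ∈ Ioo a b) : 0 ≤ g s := by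
  have hconv : ConvexOn ℝ (Ioo a b) g := by
    refine MonotoneOn.convexOn_of_deriv (convex_Ioo a b)
      (fun s hs => (hg s hs).continuousAt.continuousWithinAt) ?_ ?_ <;> rw [interior_Ioo]
    · exact fun s hs => (hg s hs).differentiableAt.differentiableWithinAt
    · exact hk.congr fun s hs => ((hg s hs).deriv).symm
  have hmin : IsMinOn g (Ioo a b) 0 :=
    hconv.isMinOn_of_rightDeriv_eq_zero (by rwa [interior_Ioo])
      (((hg 0 h0).hasDerivWithinAt.derivWithin (uniqueDiffWithinAt_Ioi 0)).trans hk₀)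
  exact hg₀ ▸ hmin hs

theorem Profile.exists_amplitude (P : Profile) : Nonempty (Amplitude P) := by
  obtain ⟨ha, hb⟩ := P.zero_mem_domain
  obtain ⟨g, k, hg₀, hk₀, hg, hk⟩ := exists_second_order_ode ha hb
    P.continuousOn_amplitudeRate (fun _ _ => P.exists_abs_amplitudeRate_le)
    fun _ _ => P.exists_lipschitzWith_amplitudeRate
  have hmono : MonotoneOn k P.domain := monotoneOn_of_hasDerivAt_nonneg hk fun η hη =>
    pow_nonneg (P.meanInv_nonneg hη (le_max_right _ _)) 3
  have g_nonneg : ∀ η ∈ P.domain, 0 ≤ g η := fun η hη =>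
    nonneg_of_monotoneOn_hasDerivAt P.zero_mem_domain hg₀ hk₀ hg hmono hη
  refine ⟨⟨g, k, hg₀, hk₀, g_nonneg, fun η hη h => hk₀ ▸ hmono P.zero_mem_domain hη h, hg,
    fun η hη => ?_⟩⟩
  have := hk η hη
  rwa [Profile.amplitudeRate, max_eq_left (g_nonneg η hη)] at this

/-- A solution `η` of `dη/dt = 1/q(η)`, `η(0) = 0`, with values in `(a, b)`, on a bounded interval
`(start, finish)` of time at the end of which `η` reaches `b`. -/
structure TimeChange (q : ℝ → ℝ) (a b : ℝ) where
  (start finish : ℝ)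
  η : ℝ → ℝ
  start_neg : start < 0
  finish_pos : 0 < finish
  η_zero : η 0 = 0
  η_mem : ∀ t ∈ Ioo start finish, η t ∈ Ioo a b
  deriv_η : ∀ t ∈ Ioo start finish, HasDerivAt η (q (η t))⁻¹ t
  η_nonneg : ∀ t ∈ Ico 0 finish, 0 ≤ η t
  tendsto_η : Tendsto η (𝓝[<] finish) (𝓝[<] b)

theorem hasDerivAt_primitive {a b c η : ℝ} {q : ℝ → ℝ} (hq : ContinuousOn q (Ioo a b))
    (hc : c ∈ Ioo a b) (hη : η ∈ Ioo a b) :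
    HasDerivAt (fun x => ∫ s in c..x, q s) (q η) η :=
  intervalIntegral.integral_hasDerivAt_right
    (hq.mono (ordConnected_Ioo.uIcc_subset hc hη)).intervalIntegrable
    (hq.stronglyMeasurableAtFilter isOpen_Ioo η hη) (hq.continuousAt (isOpen_Ioo.mem_nhds hη))

theorem bijOn_Ioo_of_strictMonoOn {b c : ℝ} {τ : ℝ → ℝ} (hτ : StrictMonoOn τ (Ico c b))
    (hcont : ContinuousOn τ (Ico c b)) (hcb : c < b) (hbdd : BddAbove (τ '' Ico c b)) :
    BijOn τ (Ioo c b) (Ioo (τ c) (sSup (τ '' Ico c b))) := by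
  have hc : c ∈ Ico c b := ⟨le_rfl, hcb⟩
  refine ⟨fun x hx => ⟨hτ hc ⟨hx.1.le, hx.2⟩ hx.1, ?_⟩, (hτ.injOn).mono Ioo_subset_Ico_self,
    fun t ht => ?_⟩
  · obtain ⟨y, hxy, hyb⟩ := exists_between hx.2
    have hy : y ∈ Ico c b := ⟨(hx.1.trans hxy).le, hyb⟩
    exact (hτ ⟨hx.1.le, hx.2⟩ hy hxy).trans_le (le_csSup hbdd (mem_image_of_mem τ hy))
  · obtain ⟨_, ⟨y, hy, rfl⟩, hty⟩ := exists_lt_of_lt_csSup ⟨τ c, mem_image_of_mem τ hc⟩ ht.2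
    obtain ⟨x, hx, rfl⟩ := intermediate_value_Ioo hy.1
      (hcont.mono (Icc_subset_Ico_right hy.2)) ⟨ht.1, hty⟩
    exact mem_image_of_mem τ ⟨hx.1, hx.2.trans hy.2⟩

theorem strictMonoOn_of_hasDerivAt_pos {a b : ℝ} {τ q : ℝ → ℝ}
    (hτ : ∀ η ∈ Ioo a b, HasDerivAt τ (q η) η) (hq : ∀ η ∈ Ioo a b, 0 < q η) :
    StrictMonoOn τ (Ioo a b) :=
  strictMonoOn_of_hasDerivWithinAt_pos (convex_Ioo a b)
    (fun η hη => (hτ η hη).continuousAt.continuousWithinAt)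
    (fun η hη => (hτ η (interior_subset hη)).hasDerivWithinAt)
    fun η hη => hq η (interior_subset hη)

theorem nonempty_timeChange_of_clock {a b c : ℝ} {τ q : ℝ → ℝ} (hac : a < c) (hc : c < 0)
    (hb : 0 < b) (deriv_τ : ∀ η ∈ Ioo a b, HasDerivAt τ (q η) η) (hq : ∀ η ∈ Ioo a b, 0 < q η)
    (τ_zero : τ 0 = 0) (τ_bdd : BddAbove (τ '' Ico c b)) : Nonempty (TimeChange q a b) := by
  have τ_mono := strictMonoOn_of_hasDerivAt_pos deriv_τ hq
  have h_sub : Ico c b ⊆ Ioo a b := Ico_subset_Ioo_left hac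
  have h0 : (0 : ℝ) ∈ Ioo c b := ⟨hc, hb⟩
  have τ_bij := bijOn_Ioo_of_strictMonoOn (τ_mono.mono h_sub)
    (fun η hη => (deriv_τ η (h_sub hη)).continuousAt.continuousWithinAt) (hc.trans hb) τ_bdd
  set finish := sSup (τ '' Ico c b)
  set e := invFunOn τ (Ioo c b)
  have e_inv : InvOn e τ (Ioo c b) (Ioo (τ c) finish) := τ_bij.invOn_invFunOn
  have e_bij : BijOn e (Ioo (τ c) finish) (Ioo c b) := τ_bij.symm e_inv.symm
  have e_mem : ∀ t ∈ Ioo (τ c) finish, e t ∈ Ioo a b := fun t ht =>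
    h_sub (Ioo_subset_Ico_self (e_bij.mapsTo ht))
  have e_mono : StrictMonoOn e (Ioo (τ c) finish) := fun s hs t ht hst => by
    rwa [← τ_mono.lt_iff_lt (e_mem s hs) (e_mem t ht), e_inv.2 hs, e_inv.2 ht]
  have e_zero : e 0 = 0 := by
    rw [← τ_zero, e_inv.1 h0, τ_zero]
  have zero_mem : (0 : ℝ) ∈ Ioo (τ c) finish := τ_zero ▸ τ_bij.mapsTo h0
  refine ⟨⟨τ c, finish, e, zero_mem.1, zero_mem.2, e_zero, e_mem, fun t ht => ?_,
    fun t ht => ?_, tendsto_nhdsWithin_iff.2 ⟨?_, ?_⟩⟩⟩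
  · have e_cont : ContinuousAt e t :=
      e_mono.continuousAt_of_image_mem_nhds (isOpen_Ioo.mem_nhds ht)
        (e_bij.image_eq ▸ isOpen_Ioo.mem_nhds (e_bij.mapsTo ht))
    refine HasDerivAt.of_local_left_inverse e_cont (deriv_τ _ (e_mem t ht))
      (hq _ (e_mem t ht)).ne' ?_
    filter_upwards [isOpen_Ioo.mem_nhds ht] with s hs using e_inv.2 hs
  · exact e_zero ▸ e_mono.monotoneOn zero_mem ⟨zero_mem.1.trans_le ht.1, ht.2⟩ ht.1
  · have := e_mono.monotoneOn.tendsto_nhdsWithin_Ioo_left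
      (nonempty_Ioo.2 (zero_mem.1.trans zero_mem.2)) (e_bij.image_eq ▸ bddAbove_Ioo)
    rwa [e_bij.image_eq, csSup_Ioo (hc.trans hb)] at this
  · filter_upwards [Ioo_mem_nhdsLT (zero_mem.1.trans zero_mem.2)] with t ht
      using (e_bij.mapsTo ht).2

theorem nonempty_timeChange {a b : ℝ} (ha : a < 0) (hb : 0 < b) {q : ℝ → ℝ}
    (hq : ContinuousOn q (Ioo a b)) (hpos : ∀ η ∈ Ioo a b, 0 < q η) {B : ℝ}
    (hB : ∀ η ∈ Ico 0 b, ∫ s in (0 : ℝ)..η, q s ≤ B) : Nonempty (TimeChange q a b) := by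
  have deriv_clock : ∀ η ∈ Ioo a b, HasDerivAt (fun η => ∫ s in (0 : ℝ)..η, q s) (q η) η :=
    fun η => hasDerivAt_primitive hq ⟨ha, hb⟩
  have h_half : a / 2 < 0 := by linarith
  have h_sub : Ico (a / 2) b ⊆ Ioo a b := Ico_subset_Ioo_left (by linarith)
  refine nonempty_timeChange_of_clock (h_sub ⟨le_rfl, h_half.trans hb⟩).1 h_half hb deriv_clock
    hpos intervalIntegral.integral_same ⟨B, forall_mem_image.2 fun η hη => ?_⟩
  have h_max : max η 0 ∈ Ico 0 b := ⟨le_max_right _ _, max_lt hη.2 hb⟩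
  exact ((strictMonoOn_of_hasDerivAt_pos deriv_clock hpos).monotoneOn (h_sub hη)
    (h_sub ⟨h_half.le.trans h_max.1, h_max.2⟩) (le_max_left _ _)).trans (hB _ h_max)

namespace TimeChange

variable {q : ℝ → ℝ} {a b t : ℝ} (c : TimeChange q a b) {F : ℝ → ℝ → ℝ} {f : ℝ → ℝ} {f' : ℝ}
  {S : Set ℝ}

theorem continuousOn_η : ContinuousOn c.η (Ioo c.start c.finish) := fun t ht =>
  (c.deriv_η t ht).continuousAt.continuousWithinAt

theorem continuousOn_comp (hf : ContinuousOn f (Ioo a b)) :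
    ContinuousOn (fun t => f (c.η t)) (Ioo c.start c.finish) :=
  hf.comp c.continuousOn_η c.η_mem

theorem continuousOn_comp_uncurry (hF : ContinuousOn (uncurry F) (Ioo a b ×ˢ S)) :
    ContinuousOn (uncurry fun t x => F (c.η t) x) (Ioo c.start c.finish ×ˢ S) :=
  hF.comp ((c.continuousOn_η.comp continuousOn_fst fun _ hp => hp.1).prodMk continuousOn_snd)
    fun p hp => ⟨c.η_mem p.1 hp.1, hp.2⟩

theorem hasDerivAt_comp (ht : t ∈ Ioo c.start c.finish) (hq : q (c.η t) ≠ 0)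
    (hf : HasDerivAt f (f' * q (c.η t)) (c.η t)) : HasDerivAt (fun s => f (c.η s)) f' t :=
  (hf.comp t (c.deriv_η t ht)).congr_deriv (mul_inv_cancel_right₀ hq f')

end TimeChange

theorem continuousOn_add_mul {a b u : ℝ → ℝ} {S T : Set ℝ} (ha : ContinuousOn a S)
    (hb : ContinuousOn b S) (hu : ContinuousOn u T) :
    ContinuousOn (uncurry fun η x => a x + b x * u η) (T ×ˢ S) :=
  (ha.comp continuousOn_snd fun _ hp => hp.2).add
    ((hb.comp continuousOn_snd fun _ hp => hp.2).mul
      (hu.comp continuousOn_fst fun _ hp => hp.1))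

theorem continuousOn_mul_left {a : ℝ → ℝ} {F : ℝ → ℝ → ℝ} {S T : Set ℝ} (ha : ContinuousOn a T)
    (hF : ContinuousOn (uncurry F) (T ×ˢ S)) :
    ContinuousOn (uncurry fun η x => a η * F η x) (T ×ˢ S) :=
  (ha.comp continuousOn_fst fun _ hp => hp.1).mul hF

namespace Amplitude

variable {P : Profile} (A : Amplitude P) {η : ℝ}

/-- The reciprocal Jacobian at stretched time `η`, up to normalisation. -/
def denom (η x : ℝ) : ℝ := P.denom η (A.g η) x

/-- The `η`-derivative of `denom`. -/
def denomDeriv (η x : ℝ) : ℝ := -P.h x + P.r x * A.k η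

/-- The space derivative of `denom`. -/
def denomGrad (η x : ℝ) : ℝ := -P.h' x * η + P.r' x * A.g η

/-- The mixed derivative of `denom`. -/
def denomDerivGrad (η x : ℝ) : ℝ := -P.h' x + P.r' x * A.k η

/-- The normalising factor that gives the Jacobian mean one. -/
def meanInv (η : ℝ) : ℝ := P.meanInv η (A.g η)

/-- The derivative of `meanInv`. -/
def meanInvDeriv (η : ℝ) : ℝ := ∫ x in (0 : ℝ)..1, -A.denomDeriv η x / A.denom η x ^ 2

/-- The second derivative of `meanInv`. -/
def meanInvDerivTwo (η : ℝ) : ℝ :=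
  ∫ x in (0 : ℝ)..1,
    (2 * A.denomDeriv η x ^ 2 / A.denom η x ^ 3 - P.r x * A.meanInv η ^ 3 / A.denom η x ^ 2)

theorem continuousOn_g : ContinuousOn A.g P.domain := fun η hη =>
  (A.deriv_g η hη).continuousAt.continuousWithinAt

theorem continuousOn_k : ContinuousOn A.k P.domain := fun η hη =>
  (A.deriv_k η hη).continuousAt.continuousWithinAt

theorem denom_pos (hη : η ∈ P.domain) (x : ℝ) : 0 < A.denom η x :=
  P.denom_pos hη (A.g_nonneg η hη) x

theorem hasDerivAt_denom (hη : η ∈ P.domain) (x : ℝ) :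
    HasDerivAt (fun η => A.denom η x) (A.denomDeriv η x) η := by
  refine ((((hasDerivAt_id η).const_mul (P.h x)).const_sub 1).add
    ((A.deriv_g η hη).const_mul (P.r x))).congr_deriv ?_
  simp [denomDeriv]

theorem hasDerivAt_denomDeriv (hη : η ∈ P.domain) (x : ℝ) :
    HasDerivAt (fun η => A.denomDeriv η x) (P.r x * A.meanInv η ^ 3) η :=
  ((A.deriv_k η hη).const_mul (P.r x)).const_add (-P.h x)

theorem hasDerivWithinAt_denom {x : ℝ} (hx : x ∈ Icc (0 : ℝ) 1) :
    HasDerivWithinAt (A.denom η) (A.denomGrad η x) (Icc 0 1) x := by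
  refine ((((P.deriv_h x hx).mul_const η).const_sub 1).add
    ((P.deriv_r x hx).mul_const _)).congr_deriv ?_
  simp only [denomGrad, neg_mul]

theorem hasDerivWithinAt_denomDeriv {x : ℝ} (hx : x ∈ Icc (0 : ℝ) 1) :
    HasDerivWithinAt (A.denomDeriv η) (A.denomDerivGrad η x) (Icc 0 1) x :=
  (P.deriv_h x hx).neg.add ((P.deriv_r x hx).mul_const _)

theorem continuousOn_denom : ContinuousOn (uncurry A.denom) (P.domain ×ˢ univ) := by
  have := P.continuous_h
  have := P.continuous_r
  have hg : ContinuousOn (fun p : ℝ × ℝ => A.g p.1) (P.domain ×ˢ univ) :=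
    A.continuousOn_g.comp continuousOn_fst fun _ hp => hp.1
  change ContinuousOn (fun p : ℝ × ℝ => 1 - P.h p.2 * p.1 + P.r p.2 * A.g p.1) _
  fun_prop

theorem continuousOn_denomDeriv : ContinuousOn (uncurry A.denomDeriv) (P.domain ×ˢ univ) :=
  continuousOn_add_mul P.continuous_h.continuousOn.neg P.continuous_r.continuousOn A.continuousOn_k

theorem continuousOn_denomGrad : ContinuousOn (uncurry A.denomGrad) (P.domain ×ˢ Icc 0 1) := by
  have hh' : ContinuousOn (fun p : ℝ × ℝ => P.h' p.2) (P.domain ×ˢ Icc 0 1) :=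
    P.continuousOn_h'.comp continuousOn_snd fun _ hp => hp.2
  have hr' : ContinuousOn (fun p : ℝ × ℝ => P.r' p.2) (P.domain ×ˢ Icc 0 1) :=
    P.continuousOn_r'.comp continuousOn_snd fun _ hp => hp.2
  have hg : ContinuousOn (fun p : ℝ × ℝ => A.g p.1) (P.domain ×ˢ Icc 0 1) :=
    A.continuousOn_g.comp continuousOn_fst fun _ hp => hp.1
  exact (hh'.neg.mul continuousOn_fst).add (hr'.mul hg)

theorem continuousOn_denomDerivGrad :
    ContinuousOn (uncurry A.denomDerivGrad) (P.domain ×ˢ Icc 0 1) :=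
  continuousOn_add_mul P.continuousOn_h'.neg P.continuousOn_r' A.continuousOn_k

theorem continuousOn_inv_denom :
    ContinuousOn (uncurry fun η x => (A.denom η x)⁻¹) (P.domain ×ˢ univ) :=
  A.continuousOn_denom.inv₀ fun p hp => (A.denom_pos hp.1 p.2).ne'

theorem continuousOn_deriv_inv_denom :
    ContinuousOn (uncurry fun η x => -A.denomDeriv η x / A.denom η x ^ 2)
      (P.domain ×ˢ univ) :=
  A.continuousOn_denomDeriv.neg.div (A.continuousOn_denom.pow 2) fun p hp =>
    pow_ne_zero 2 (A.denom_pos hp.1 p.2).ne'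

theorem hasDerivAt_meanInv (hη : η ∈ P.domain) :
    HasDerivAt A.meanInv (A.meanInvDeriv η) η :=
  hasDerivAt_parametric_integral isOpen_Ioo zero_le_one
    (fun _ hs => (continuous_slice A.continuousOn_inv_denom hs).continuousOn)
    (A.continuousOn_deriv_inv_denom.mono (prod_mono_right (subset_univ _)))
    (fun _ hs x _ => (A.hasDerivAt_denom hs x).inv (A.denom_pos hs x).ne') hη

theorem continuousOn_meanInv : ContinuousOn A.meanInv P.domain := fun _ hη =>
  (A.hasDerivAt_meanInv hη).continuousAt.continuousWithinAt

theorem meanInv_pos (hη : η ∈ P.domain) : 0 < A.meanInv η :=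
  intervalIntegral.integral_pos zero_lt_one
    (continuous_slice A.continuousOn_inv_denom hη).continuousOn
    (fun x _ => (inv_pos.2 (A.denom_pos hη x)).le)
    ⟨0, left_mem_Icc.2 zero_le_one, inv_pos.2 (A.denom_pos hη 0)⟩

theorem continuousOn_deriv_two_inv_denom :
    ContinuousOn (uncurry fun η x => 2 * A.denomDeriv η x ^ 2 / A.denom η x ^ 3
      - P.r x * A.meanInv η ^ 3 / A.denom η x ^ 2) (P.domain ×ˢ univ) := by
  have h_meanInv : ContinuousOn (fun p : ℝ × ℝ => A.meanInv p.1) (P.domain ×ˢ univ) :=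
    A.continuousOn_meanInv.comp continuousOn_fst fun _ hp => hp.1
  have hr : ContinuousOn (fun p : ℝ × ℝ => P.r p.2) (P.domain ×ˢ univ) :=
    (P.continuous_r.comp continuous_snd).continuousOn
  exact ((continuousOn_const.mul (A.continuousOn_denomDeriv.pow 2)).div
    (A.continuousOn_denom.pow 3) fun p hp => pow_ne_zero 3 (A.denom_pos hp.1 p.2).ne').sub
    ((hr.mul (h_meanInv.pow 3)).div (A.continuousOn_denom.pow 2)
      fun p hp => pow_ne_zero 2 (A.denom_pos hp.1 p.2).ne')

theorem hasDerivAt_meanInvDeriv (hη : η ∈ P.domain) :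
    HasDerivAt A.meanInvDeriv (A.meanInvDerivTwo η) η := by
  refine hasDerivAt_parametric_integral isOpen_Ioo zero_le_one
    (fun _ hs => (continuous_slice A.continuousOn_deriv_inv_denom hs).continuousOn)
    (A.continuousOn_deriv_two_inv_denom.mono (prod_mono_right (subset_univ _)))
    (fun s hs x _ => ?_) hη
  have hne := (A.denom_pos hs x).ne'
  refine ((A.hasDerivAt_denomDeriv hs x).fun_neg.div ((A.hasDerivAt_denom hs x).fun_pow 2)
    (pow_ne_zero 2 hne)).congr_deriv ?_
  push_cast
  field_simp
  ring

theorem continuousOn_meanInvDeriv : ContinuousOn A.meanInvDeriv P.domain := fun _ hη =>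
  (A.hasDerivAt_meanInvDeriv hη).continuousAt.continuousWithinAt

theorem continuousOn_meanInvDerivTwo : ContinuousOn A.meanInvDerivTwo P.domain :=
  continuousOn_parametric_integral zero_le_one
    (A.continuousOn_deriv_two_inv_denom.mono (prod_mono_right (subset_univ _)))

theorem denom_zero (x : ℝ) : A.denom 0 x = 1 := by
  simp [denom, Profile.denom, A.g_zero]

theorem denomDeriv_zero (x : ℝ) : A.denomDeriv 0 x = -P.h x := by
  simp [denomDeriv, A.k_zero]

theorem meanInv_zero : A.meanInv 0 = 1 := by
  simp [meanInv, Profile.meanInv, Profile.denom, A.g_zero]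

theorem meanInvDeriv_zero : A.meanInvDeriv 0 = 0 := by
  simp [meanInvDeriv, A.denom_zero, A.denomDeriv_zero, P.integral_h]

/-- The reciprocal Jacobian of the flow, as a function of the stretched time. -/
def invJac (η x : ℝ) : ℝ := A.meanInv η * A.denom η x

/-- The derivative of `invJac` with respect to physical time, `dη/dt = meanInv⁻²`. -/
def invJacRate (η x : ℝ) : ℝ :=
  (A.meanInvDeriv η * A.denom η x + A.meanInv η * A.denomDeriv η x) / A.meanInv η ^ 2

/-- The space derivative of `invJac`. -/
def invJacGrad (η x : ℝ) : ℝ := A.meanInv η * A.denomGrad η x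

/-- The space derivative of `invJacRate`. -/
def invJacRateGrad (η x : ℝ) : ℝ :=
  (A.meanInvDeriv η * A.denomGrad η x + A.meanInv η * A.denomDerivGrad η x) / A.meanInv η ^ 2

/-- The coefficient `c` of the linear equation `w_tt + c w = ρ₀` satisfied by `w = invJac` along
each trajectory. -/
def lagrangianCoeff (η : ℝ) : ℝ :=
  2 * A.meanInvDeriv η ^ 2 / A.meanInv η ^ 6 - A.meanInvDerivTwo η / A.meanInv η ^ 5

theorem hasDerivAt_invJac (hη : η ∈ P.domain) (x : ℝ) :
    HasDerivAt (fun η => A.invJac η x) (A.invJacRate η x * A.meanInv η ^ 2) η := by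
  refine ((A.hasDerivAt_meanInv hη).mul (A.hasDerivAt_denom hη x)).congr_deriv ?_
  exact (div_mul_cancel₀ _ (pow_ne_zero 2 (A.meanInv_pos hη).ne')).symm

theorem hasDerivAt_invJacRate (hη : η ∈ P.domain) (x : ℝ) :
    HasDerivAt (fun η => A.invJacRate η x)
      ((P.r x - A.lagrangianCoeff η * A.invJac η x) * A.meanInv η ^ 2) η := by
  have hne := (A.meanInv_pos hη).ne'
  have deriv_meanInv := A.hasDerivAt_meanInv hη
  refine ((((A.hasDerivAt_meanInvDeriv hη).fun_mul (A.hasDerivAt_denom hη x)).fun_add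
    (deriv_meanInv.fun_mul (A.hasDerivAt_denomDeriv hη x))).fun_div (deriv_meanInv.fun_pow 2)
    (pow_ne_zero 2 hne)).congr_deriv ?_
  simp only [invJac, lagrangianCoeff]
  push_cast
  field_simp
  ring

theorem continuousOn_rate {F F' : ℝ → ℝ → ℝ} {S : Set ℝ}
    (hF : ContinuousOn (uncurry F) (P.domain ×ˢ S))
    (hF' : ContinuousOn (uncurry F') (P.domain ×ˢ S)) :
    ContinuousOn (uncurry fun η x =>
      (A.meanInvDeriv η * F η x + A.meanInv η * F' η x) / A.meanInv η ^ 2) (P.domain ×ˢ S) :=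
  ((continuousOn_mul_left A.continuousOn_meanInvDeriv hF).add
    (continuousOn_mul_left A.continuousOn_meanInv hF')).div
    ((A.continuousOn_meanInv.comp continuousOn_fst fun _ hp => hp.1).pow 2)
    fun _ hp => pow_ne_zero 2 (A.meanInv_pos hp.1).ne'

theorem continuousOn_lagrangianCoeff : ContinuousOn A.lagrangianCoeff P.domain :=
  ((continuousOn_const.mul (A.continuousOn_meanInvDeriv.pow 2)).div
    (A.continuousOn_meanInv.pow 6) fun _ hη => pow_ne_zero 6 (A.meanInv_pos hη).ne').sub
    (A.continuousOn_meanInvDerivTwo.div (A.continuousOn_meanInv.pow 5)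
      fun _ hη => pow_ne_zero 5 (A.meanInv_pos hη).ne')

theorem invJac_pos (hη : η ∈ P.domain) (x : ℝ) : 0 < A.invJac η x :=
  mul_pos (A.meanInv_pos hη) (A.denom_pos hη x)

theorem exists_invJac_le (hη : η ∈ P.domain) : ∃ B, ∀ x, A.invJac η x ≤ B := by
  refine ⟨A.meanInv η * (1 + P.H * |η| + P.H * A.g η), fun x =>
    mul_le_mul_of_nonneg_left ?_ (A.meanInv_pos hη).le⟩
  have h_mul_le : -(P.h x * η) ≤ P.H * |η| := by
    refine (neg_le_abs _).trans ?_
    rw [abs_mul]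
    exact mul_le_mul_of_nonneg_right (P.abs_h_le x) (abs_nonneg _)
  have r_mul_le := mul_le_mul_of_nonneg_right (P.r_le x) (A.g_nonneg η hη)
  unfold denom Profile.denom
  linarith

theorem integral_inv_invJac (hη : η ∈ P.domain) :
    ∫ x in (0 : ℝ)..1, (A.invJac η x)⁻¹ = 1 := by
  simp only [invJac, mul_inv]
  rw [intervalIntegral.integral_const_mul]
  exact inv_mul_cancel₀ (A.meanInv_pos hη).ne'

/-- The passage from stretched time `η` to physical time `t`. -/
abbrev Clock : Type := TimeChange (fun η => A.meanInv η ^ 2) (-P.H⁻¹) P.M⁻¹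

/-- The flow in Lagrangian coordinates obtained from the amplitude by the change of time `c`. -/
def lagrangianFlow (c : A.Clock) : LagrangianFlow where
  h := P.h
  r := P.r
  r' := P.r'
  a := c.start
  b := c.finish
  w t := A.invJac (c.η t)
  wt t := A.invJacRate (c.η t)
  wx t := A.invJacGrad (c.η t)
  wtx t := A.invJacRateGrad (c.η t)
  c t := A.lagrangianCoeff (c.η t)
  zero_mem := ⟨c.start_neg, c.finish_pos⟩
  continuous_r := P.continuous_r
  deriv_r := P.deriv_r
  continuousOn_r' := P.continuousOn_r'
  r_zero := P.r_zero
  r_one := P.r_one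
  continuousOn_w := c.continuousOn_comp_uncurry
    (continuousOn_mul_left A.continuousOn_meanInv A.continuousOn_denom)
  continuousOn_wt := c.continuousOn_comp_uncurry
    (A.continuousOn_rate A.continuousOn_denom A.continuousOn_denomDeriv)
  continuousOn_wx := c.continuousOn_comp_uncurry
    (continuousOn_mul_left A.continuousOn_meanInv A.continuousOn_denomGrad)
  continuousOn_wtx := c.continuousOn_comp_uncurry
    (A.continuousOn_rate A.continuousOn_denomGrad A.continuousOn_denomDerivGrad)
  continuousOn_c := c.continuousOn_comp A.continuousOn_lagrangianCoeff
  w_pos t ht := A.invJac_pos (c.η_mem t ht)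
  exists_w_le t ht := A.exists_invJac_le (c.η_mem t ht)
  deriv_w t ht x := c.hasDerivAt_comp ht (pow_ne_zero 2 (A.meanInv_pos (c.η_mem t ht)).ne')
    (A.hasDerivAt_invJac (c.η_mem t ht) x)
  deriv_wt t ht x := c.hasDerivAt_comp ht (pow_ne_zero 2 (A.meanInv_pos (c.η_mem t ht)).ne')
    (A.hasDerivAt_invJacRate (c.η_mem t ht) x)
  deriv_wx _ _ _ hx := (A.hasDerivWithinAt_denom hx).const_mul _
  deriv_wtx _ _ _ hx := (((A.hasDerivWithinAt_denom hx).const_mul _).add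
    ((A.hasDerivWithinAt_denomDeriv hx).const_mul _)).div_const _
  integral_inv_w t ht := A.integral_inv_invJac (c.η_mem t ht)
  init_w x := by rw [c.η_zero, invJac, A.meanInv_zero, A.denom_zero, mul_one]
  init_wt x := by
    simp [c.η_zero, invJacRate, A.meanInv_zero, A.meanInvDeriv_zero, A.denomDeriv_zero]

end Amplitude

theorem deriv_mul_sub_nonneg_of_isMinOn {q : ℝ → ℝ} {q' x y : ℝ} {s : Set ℝ} (hs : Convex ℝ s)
    (hq : HasDerivWithinAt q q' s x) (hmin : IsMinOn q s x) (hx : x ∈ s) (hy : y ∈ s) :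
    0 ≤ q' * (y - x) := by
  have := hmin.localize.hasFDerivWithinAt_nonneg hq.hasFDerivWithinAt
    (sub_mem_posTangentConeAt_of_segment_subset (hs.segment_subset hx hy))
  simpa [mul_comm] using this

theorem deriv_mul_sub_nonpos_of_isMaxOn {q : ℝ → ℝ} {q' x y : ℝ} {s : Set ℝ} (hs : Convex ℝ s)
    (hq : HasDerivWithinAt q q' s x) (hmax : IsMaxOn q s x) (hx : x ∈ s) (hy : y ∈ s) :
    q' * (y - x) ≤ 0 := by
  have := deriv_mul_sub_nonneg_of_isMinOn hs hq.neg hmax.neg hx hy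
  linarith

theorem eq_zero_or_one_of_isMaxOn {q : ℝ → ℝ} {q' x : ℝ}
    (hq : HasDerivWithinAt q q' (Icc 0 1) x) (hmax : IsMaxOn q (Icc 0 1) x)
    (hx : x ∈ Icc (0 : ℝ) 1) (hne : q' ≠ 0) : x = 0 ∨ x = 1 := by
  by_contra! h
  have h0 : 0 < x := hx.1.lt_of_ne' h.1
  have h1 : x < 1 := hx.2.lt_of_ne h.2
  have toward_zero := deriv_mul_sub_nonpos_of_isMaxOn (convex_Icc 0 1) hq hmax hx
    (left_mem_Icc.2 zero_le_one)
  have toward_one := deriv_mul_sub_nonpos_of_isMaxOn (convex_Icc 0 1) hq hmax hx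
    (right_mem_Icc.2 zero_le_one)
  exact hne (le_antisymm (by nlinarith) (by nlinarith))

theorem mul_one_sub_nonneg {x : ℝ} (hx : x ∈ Icc (0 : ℝ) 1) : 0 ≤ x * (1 - x) :=
  mul_nonneg hx.1 (sub_nonneg.2 hx.2)

theorem mul_one_sub_le_abs_sub {x y : ℝ} (hx : x ∈ Icc (0 : ℝ) 1) (hy : y = 0 ∨ y = 1) :
    x * (1 - x) ≤ |x - y| := by
  rcases hy with rfl | rfl
  · rw [sub_zero, abs_of_nonneg hx.1]
    nlinarith [hx.1]
  · rw [abs_sub_comm, abs_of_nonneg (sub_nonneg.2 hx.2)]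
    nlinarith [hx.2]

theorem exists_eventually_gap {h : ℝ → ℝ} {h'y M y : ℝ}
    (hh : HasDerivWithinAt h h'y (Icc 0 1) y) (hle : ∀ x ∈ Icc (0 : ℝ) 1, h x ≤ M)
    (hy : y ∈ Icc (0 : ℝ) 1) (hne : h y = M → h'y ≠ 0) :
    ∃ c > 0, ∀ᶠ x in 𝓝[Icc 0 1] y, c * (x * (1 - x)) ≤ M - h x := by
  rcases (hle y hy).lt_or_eq with hlt | rfl
  · refine ⟨(M - h y) / 2, by linarith, ?_⟩
    filter_upwards [self_mem_nhdsWithin,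
      hh.continuousWithinAt.eventually_lt_const (show h y < (M + h y) / 2 by linarith)]
      with x hx h_lt
    have h_le_one : x * (1 - x) ≤ 1 := by nlinarith [hx.1, hx.2]
    nlinarith
  · have hy_boundary := eq_zero_or_one_of_isMaxOn hh hle hy (hne rfl)
    obtain ⟨C, hC, h_bound⟩ := (hh.isTheta_sub (hne rfl)).isBigO_symm.exists_pos
    refine ⟨C⁻¹, inv_pos.2 hC, ?_⟩
    have h_near : ∀ᶠ x in 𝓝[Icc 0 1] y, |x - y| ≤ C * |h x - h y| := by
      have := h_bound.bound
      rw [prod_pure, eventually_map] at this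
      exact this
    filter_upwards [self_mem_nhdsWithin, h_near] with x hx h_le
    rw [abs_sub_comm (h x), abs_of_nonneg (sub_nonneg.2 (hle x hx))] at h_le
    rw [inv_mul_le_iff₀ hC]
    exact (mul_one_sub_le_abs_sub hx hy_boundary).trans h_le

theorem exists_gap {h h' : ℝ → ℝ} {M : ℝ}
    (hh : ∀ x ∈ Icc (0 : ℝ) 1, HasDerivWithinAt h (h' x) (Icc 0 1) x)
    (hle : ∀ x ∈ Icc (0 : ℝ) 1, h x ≤ M) (hne : ∀ x ∈ Icc (0 : ℝ) 1, h x = M → h' x ≠ 0) :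
    ∃ c > 0, ∀ x ∈ Icc (0 : ℝ) 1, c * (x * (1 - x)) ≤ M - h x := by
  suffices H : ∃ c > 0, ∀ x ∈ Icc (0 : ℝ) 1, x ∈ Icc (0 : ℝ) 1 → c * (x * (1 - x)) ≤ M - h x by
    obtain ⟨c, hc, H⟩ := H
    exact ⟨c, hc, fun x hx => H x hx hx⟩
  refine isCompact_Icc.induction_on
    (p := fun s => ∃ c > 0, ∀ x ∈ s, x ∈ Icc (0 : ℝ) 1 → c * (x * (1 - x)) ≤ M - h x)
    ⟨1, one_pos, by simp⟩ (fun s t hst => fun ⟨c, hc, H⟩ => ⟨c, hc, fun x hx => H x (hst hx)⟩)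
    ?_ fun y hy => ?_
  · rintro s t ⟨c, hc, hs⟩ ⟨d, hd, ht⟩
    refine ⟨min c d, lt_min hc hd, fun x hx hx' => ?_⟩
    have := mul_one_sub_nonneg hx'
    rcases hx with hx | hx
    · exact (mul_le_mul_of_nonneg_right (min_le_left _ _) this).trans (hs x hx hx')
    · exact (mul_le_mul_of_nonneg_right (min_le_right _ _) this).trans (ht x hx hx')
  · obtain ⟨c, hc, h_ev⟩ := exists_eventually_gap (hh y hy) hle hy (hne y hy)
    exact ⟨_, h_ev, c, hc, fun x hx _ => hx⟩

theorem rpow_mul_rpow_le_add {u v : ℝ} (hu : 0 ≤ u) (hv : 0 ≤ v) :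
    u ^ (1 / 4 : ℝ) * v ^ (3 / 4 : ℝ) ≤ u + v := by
  have := Real.geom_mean_le_arith_mean2_weighted (w₁ := 1 / 4) (w₂ := 3 / 4) (by norm_num)
    (by norm_num) hu hv (by norm_num)
  linarith

theorem inv_rpow_mul_one_sub_le {x : ℝ} (hx : x ∈ Ioo (0 : ℝ) 1) :
    ((x * (1 - x)) ^ (3 / 4 : ℝ))⁻¹ ≤ x ^ (-(3 / 4) : ℝ) + (1 - x) ^ (-(3 / 4) : ℝ) := by
  have h0 : 0 < x := hx.1
  have h1 : 0 < 1 - x := sub_pos.2 hx.2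
  have partial_fractions : (x * (1 - x))⁻¹ = x⁻¹ + (1 - x)⁻¹ := by field_simp; ring
  rw [← Real.inv_rpow (by positivity), partial_fractions, Real.rpow_neg h0.le,
    Real.rpow_neg h1.le, ← Real.inv_rpow h0.le, ← Real.inv_rpow h1.le]
  exact Real.rpow_add_le_add_rpow (by positivity) (by positivity) (by norm_num) (by norm_num)

theorem intervalIntegrable_inv_add {ε : ℝ} (hε : 0 < ε) :
    IntervalIntegrable (fun x : ℝ => (ε + x * (1 - x))⁻¹) volume 0 1 :=
  ContinuousOn.intervalIntegrable_of_Icc zero_le_one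
    (ContinuousOn.inv₀ (by fun_prop) fun _ hx =>
      (add_pos_of_pos_of_nonneg hε (mul_one_sub_nonneg hx)).ne')

theorem integral_inv_add_le {ε : ℝ} (hε : 0 < ε) :
    ∫ x in (0 : ℝ)..1, (ε + x * (1 - x))⁻¹ ≤ (ε ^ (1 / 4 : ℝ))⁻¹ *
      ∫ x in (0 : ℝ)..1, (x ^ (-(3 / 4) : ℝ) + (1 - x) ^ (-(3 / 4) : ℝ)) := by
  have integrable_left : IntervalIntegrable (fun x : ℝ => x ^ (-(3 / 4) : ℝ)) volume 0 1 :=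
    intervalIntegral.intervalIntegrable_rpow' (by norm_num)
  have integrable_right :
      IntervalIntegrable (fun x : ℝ => (1 - x) ^ (-(3 / 4) : ℝ)) volume 0 1 := by
    have := integrable_left.comp_sub_left 1
    rw [sub_zero, sub_self] at this
    exact this.symm
  rw [← intervalIntegral.integral_const_mul]
  refine intervalIntegral.integral_mono_on_of_le_Ioo zero_le_one (intervalIntegrable_inv_add hε)
    ((integrable_left.add integrable_right).const_mul _) fun x hx => ?_
  have hx₀ : 0 < x * (1 - x) := mul_pos hx.1 (sub_pos.2 hx.2)
  calc (ε + x * (1 - x))⁻¹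
      ≤ (ε ^ (1 / 4 : ℝ) * (x * (1 - x)) ^ (3 / 4 : ℝ))⁻¹ :=
        inv_anti₀ (by positivity) (rpow_mul_rpow_le_add hε.le hx₀.le)
    _ = (ε ^ (1 / 4 : ℝ))⁻¹ * ((x * (1 - x)) ^ (3 / 4 : ℝ))⁻¹ := mul_inv _ _
    _ ≤ _ := mul_le_mul_of_nonneg_left (inv_rpow_mul_one_sub_le hx) (by positivity)

theorem integral_inv_sqrt_le {M b : ℝ} (hM : 0 < M) (hb : 0 ≤ b) (hMb : M * b < 1) :
    ∫ s in (0 : ℝ)..b, (√(1 - M * s))⁻¹ ≤ 2 / M := by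
  have h_pos : ∀ s ∈ uIcc 0 b, 0 < 1 - M * s := fun s hs => by
    rw [uIcc_of_le hb] at hs
    linarith [mul_le_mul_of_nonneg_left hs.2 hM.le]
  have h_deriv : ∀ s ∈ uIcc 0 b,
      HasDerivAt (fun s => -(2 / M) * √(1 - M * s)) (√(1 - M * s))⁻¹ s := fun s hs => by
    refine (((((hasDerivAt_id s).const_mul M).const_sub 1).sqrt (h_pos s hs).ne').const_mul
      (-(2 / M))).congr_deriv ?_
    simp only [id]
    field_simp
  have h_int : IntervalIntegrable (fun s => (√(1 - M * s))⁻¹) volume 0 b :=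
    ContinuousOn.intervalIntegrable
      (ContinuousOn.inv₀ (by fun_prop) fun s hs => (Real.sqrt_pos.2 (h_pos s hs)).ne')
  rw [intervalIntegral.integral_eq_sub_of_hasDerivAt h_deriv h_int]
  have : 0 ≤ 2 / M * √(1 - M * b) := by positivity
  simp only [mul_zero, sub_zero, Real.sqrt_one, mul_one]
  linarith

theorem sq_rpow_one_fourth {u : ℝ} (hu : 0 ≤ u) : (u ^ (1 / 4 : ℝ)) ^ 2 = √u := by
  rw [← Real.rpow_natCast, ← Real.rpow_mul hu, Real.sqrt_eq_rpow]
  norm_num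

theorem inv_rpow_one_fourth_mul_self {u : ℝ} (hu : 0 < u) :
    (u ^ (1 / 4 : ℝ))⁻¹ * u = u ^ (3 / 4 : ℝ) := by
  rw [← Real.rpow_neg hu.le, ← Real.rpow_add_one hu.ne']
  norm_num

namespace Profile

variable (P : Profile) {x η : ℝ}

/-- Nondegeneracy of the maxima: the derivative of `h` does not vanish where `h` attains `M`. -/
def Nondegenerate : Prop := ∀ x ∈ Icc (0 : ℝ) 1, P.h x = P.M → P.h' x ≠ 0

variable {P} in
theorem Nondegenerate.eq_zero_or_one (hP : P.Nondegenerate) (hx : x ∈ Icc (0 : ℝ) 1)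
    (hmax : P.h x = P.M) : x = 0 ∨ x = 1 :=
  eq_zero_or_one_of_isMaxOn (P.deriv_h x hx) (fun y _ => (P.h_le y).trans_eq hmax.symm) hx
    (hP x hx hmax)

theorem one_sub_mul_pos (hη : η < P.M⁻¹) : 0 < 1 - P.M * η := by
  have := mul_lt_mul_of_pos_left hη P.M_pos
  rwa [mul_inv_cancel₀ P.M_pos.ne', ← sub_pos] at this

theorem Ico_subset_domain : Ico 0 P.M⁻¹ ⊆ P.domain := fun _ hη =>
  ⟨P.zero_mem_domain.1.trans_le hη.1, hη.2⟩

theorem eventually_mem_Ico : ∀ᶠ η in 𝓝[<] P.M⁻¹, η ∈ Ico 0 P.M⁻¹ := by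
  filter_upwards [Ioo_mem_nhdsLT (inv_pos.2 P.M_pos)] with η hη using Ioo_subset_Ico_self hη

theorem tendsto_one_sub_mul : Tendsto (fun η => 1 - P.M * η) (𝓝[<] P.M⁻¹) (𝓝 0) := by
  have : Tendsto (fun η => 1 - P.M * η) (𝓝 P.M⁻¹) (𝓝 (1 - P.M * P.M⁻¹)) :=
    Continuous.tendsto (by fun_prop) _
  rw [mul_inv_cancel₀ P.M_pos.ne', sub_self] at this
  exact this.mono_left nhdsWithin_le_nhds

theorem r_eq_zero (hx : x = 0 ∨ x = 1) : P.r x = 0 := by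
  rcases hx with rfl | rfl
  exacts [P.r_zero, P.r_one]

theorem h'_mul_sub_nonpos {y : ℝ} (hx : x ∈ Icc (0 : ℝ) 1) (hy : y ∈ Icc (0 : ℝ) 1)
    (hmax : P.h x = P.M) : P.h' x * (y - x) ≤ 0 :=
  deriv_mul_sub_nonpos_of_isMaxOn (convex_Icc 0 1) (P.deriv_h x hx)
    (fun z _ => (P.h_le z).trans_eq hmax.symm) hx hy

theorem r'_mul_sub_nonneg {y : ℝ} (hx : x ∈ Icc (0 : ℝ) 1) (hy : y ∈ Icc (0 : ℝ) 1)
    (hmin : P.r x = 0) : 0 ≤ P.r' x * (y - x) :=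
  deriv_mul_sub_nonneg_of_isMinOn (convex_Icc 0 1) (P.deriv_r x hx)
    (fun z _ => hmin.trans_le (P.r_nonneg z)) hx hy

end Profile

theorem tendsto_mul_inv_atTop {α : Type*} {m b : α → ℝ} {l : Filter α} {q : ℝ} (hq : 0 < q)
    (hm : Tendsto m l (𝓝[>] 0)) (hb : ∀ᶠ t in l, q ≤ b t) :
    Tendsto (fun t => b t * (m t)⁻¹) l atTop := by
  have hinv : Tendsto (fun t => (m t)⁻¹) l atTop := tendsto_inv_nhdsGT_zero.comp hm
  refine tendsto_atTop_mono' l ?_ (hinv.const_mul_atTop hq)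
  filter_upwards [hb, hinv.eventually_ge_atTop 0] with t hqb hm_nonneg
  exact mul_le_mul_of_nonneg_right hqb hm_nonneg

theorem tendsto_mul_inv_atBot {α : Type*} {m b : α → ℝ} {l : Filter α} {q : ℝ} (hq : q < 0)
    (hm : Tendsto m l (𝓝[>] 0)) (hb : ∀ᶠ t in l, b t ≤ q) :
    Tendsto (fun t => b t * (m t)⁻¹) l atBot := by
  have := tendsto_mul_inv_atTop (neg_pos.2 hq) hm (hb.mono fun _ => neg_le_neg)
  simpa only [neg_mul, tendsto_neg_atTop_iff] using this

namespace Amplitude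

variable {P : Profile} (A : Amplitude P) {η x : ℝ}

theorem one_sub_add_le_denom (hη : η ∈ P.domain) (x : ℝ) :
    (1 - P.M * η) + (P.M - P.h x) * η ≤ A.denom η x := by
  have := mul_nonneg (P.r_nonneg x) (A.g_nonneg η hη)
  unfold denom Profile.denom
  linarith

theorem exists_mul_le_denom {c : ℝ} (hc : 0 < c)
    (hgap : ∀ x ∈ Icc (0 : ℝ) 1, c * (x * (1 - x)) ≤ P.M - P.h x) :
    ∃ d > 0, ∀ η ∈ Ico 0 P.M⁻¹, ∀ x ∈ Icc (0 : ℝ) 1,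
      d * ((1 - P.M * η) + x * (1 - x)) ≤ A.denom η x := by
  have hM := P.M_pos
  refine ⟨min (1 / 3) (c / (2 * P.M)), by positivity, fun η hη x hx => ?_⟩
  have hx₀ := mul_one_sub_nonneg hx
  have hη₀ := P.one_sub_mul_pos hη.2
  have gap_nonneg : 0 ≤ P.M - P.h x := sub_nonneg.2 (P.h_le x)
  refine le_trans ?_ (A.one_sub_add_le_denom (P.Ico_subset_domain hη) x)
  rcases le_total η (1 / (2 * P.M)) with h_small | h_large
  · have hMη : P.M * η ≤ 1 / 2 := by
      calc P.M * η ≤ P.M * (1 / (2 * P.M)) := by gcongr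
        _ = 1 / 2 := by field_simp
    have hx₁ : x * (1 - x) ≤ 1 := by nlinarith [hx.1, hx.2]
    calc _ ≤ 1 / 3 * ((1 - P.M * η) + x * (1 - x)) := by gcongr; exact min_le_left _ _
      _ ≤ _ := by linarith [mul_nonneg gap_nonneg hη.1]
  · rw [mul_add]
    refine add_le_add ?_ ?_
    · exact mul_le_of_le_one_left hη₀.le ((min_le_left _ _).trans (by norm_num))
    · calc min (1 / 3) (c / (2 * P.M)) * (x * (1 - x))
          ≤ c / (2 * P.M) * (x * (1 - x)) := by gcongr; exact min_le_right _ _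
        _ = c * (x * (1 - x)) * (1 / (2 * P.M)) := by ring
        _ ≤ (P.M - P.h x) * η := mul_le_mul (hgap x hx) h_large (by positivity) gap_nonneg

theorem exists_meanInv_le (hP : P.Nondegenerate) :
    ∃ C, ∀ η ∈ Ico 0 P.M⁻¹, A.meanInv η ≤ C * ((1 - P.M * η) ^ (1 / 4 : ℝ))⁻¹ := by
  obtain ⟨c, hc, hgap⟩ := exists_gap P.deriv_h (fun x _ => P.h_le x) hP
  obtain ⟨d, hd, d_le⟩ := A.exists_mul_le_denom hc hgap
  refine ⟨d⁻¹ * ∫ x in (0 : ℝ)..1, (x ^ (-(3 / 4) : ℝ) + (1 - x) ^ (-(3 / 4) : ℝ)),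
    fun η hη => ?_⟩
  have hη₀ := P.one_sub_mul_pos hη.2
  calc A.meanInv η ≤ ∫ x in (0 : ℝ)..1, d⁻¹ * ((1 - P.M * η) + x * (1 - x))⁻¹ := by
        refine intervalIntegral.integral_mono_on zero_le_one ((continuous_slice
          A.continuousOn_inv_denom (P.Ico_subset_domain hη)).intervalIntegrable _ _)
          ((intervalIntegrable_inv_add hη₀).const_mul _) fun x hx => ?_
        rw [← mul_inv]
        exact inv_anti₀ (mul_pos hd (add_pos_of_pos_of_nonneg hη₀ (mul_one_sub_nonneg hx)))
          (d_le η hη x hx)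
    _ = d⁻¹ * ∫ x in (0 : ℝ)..1, ((1 - P.M * η) + x * (1 - x))⁻¹ :=
        intervalIntegral.integral_const_mul _ _
    _ ≤ d⁻¹ * (((1 - P.M * η) ^ (1 / 4 : ℝ))⁻¹ *
          ∫ x in (0 : ℝ)..1, (x ^ (-(3 / 4) : ℝ) + (1 - x) ^ (-(3 / 4) : ℝ))) := by
        gcongr
        exact integral_inv_add_le hη₀
    _ = _ := by ring

theorem nonempty_clock (hP : P.Nondegenerate) : Nonempty A.Clock := by
  obtain ⟨C, hC⟩ := A.exists_meanInv_le hP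
  refine nonempty_timeChange P.zero_mem_domain.1 P.zero_mem_domain.2 (A.continuousOn_meanInv.pow 2)
    (fun η hη => pow_pos (A.meanInv_pos hη) 2) (B := C ^ 2 * (2 / P.M)) fun η hη => ?_
  have h_sub : Icc 0 η ⊆ Ico 0 P.M⁻¹ := fun s hs => ⟨hs.1, hs.2.trans_lt hη.2⟩
  have integrable_sq : IntervalIntegrable (fun s => A.meanInv s ^ 2) volume 0 η :=
    ((A.continuousOn_meanInv.mono (h_sub.trans P.Ico_subset_domain)).pow
      2).intervalIntegrable_of_Icc hη.1
  have integrable_inv_sqrt : IntervalIntegrable (fun s => (√(1 - P.M * s))⁻¹) volume 0 η :=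
    ContinuousOn.intervalIntegrable_of_Icc hη.1 (ContinuousOn.inv₀ (by fun_prop) fun s hs =>
      (Real.sqrt_pos.2 (P.one_sub_mul_pos (h_sub hs).2)).ne')
  calc ∫ s in (0 : ℝ)..η, A.meanInv s ^ 2
      ≤ ∫ s in (0 : ℝ)..η, C ^ 2 * (√(1 - P.M * s))⁻¹ := by
        refine intervalIntegral.integral_mono_on hη.1 integrable_sq
          (integrable_inv_sqrt.const_mul _) fun s hs => ?_
        rw [← sq_rpow_one_fourth (P.one_sub_mul_pos (h_sub hs).2).le, ← inv_pow, ← mul_pow]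
        exact pow_le_pow_left₀ (A.meanInv_pos (P.Ico_subset_domain (h_sub hs))).le
          (hC s (h_sub hs)) 2
    _ = C ^ 2 * ∫ s in (0 : ℝ)..η, (√(1 - P.M * s))⁻¹ := intervalIntegral.integral_const_mul _ _
    _ ≤ C ^ 2 * (2 / P.M) := by
        gcongr
        exact integral_inv_sqrt_le P.M_pos hη.1 (by linarith [P.one_sub_mul_pos hη.2])

theorem invJac_boundary (hx : x = 0 ∨ x = 1) (hmax : P.h x = P.M) :
    A.invJac η x = A.meanInv η * (1 - P.M * η) := by
  simp [invJac, denom, Profile.denom, hmax, P.r_eq_zero hx]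

theorem tendsto_invJac_boundary (hP : P.Nondegenerate) (hx : x ∈ Icc (0 : ℝ) 1)
    (hmax : P.h x = P.M) : Tendsto (fun η => A.invJac η x) (𝓝[<] P.M⁻¹) (𝓝[>] 0) := by
  obtain ⟨C, hC⟩ := A.exists_meanInv_le hP
  have h_pos : ∀ᶠ η in 𝓝[<] P.M⁻¹, 0 < A.invJac η x :=
    P.eventually_mem_Ico.mono fun η hη => A.invJac_pos (P.Ico_subset_domain hη) x
  have h_bound : ∀ᶠ η in 𝓝[<] P.M⁻¹, A.invJac η x ≤ C * (1 - P.M * η) ^ (3 / 4 : ℝ) := by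
    filter_upwards [P.eventually_mem_Ico] with η hη
    have hη₀ := P.one_sub_mul_pos hη.2
    rw [A.invJac_boundary (hP.eq_zero_or_one hx hmax) hmax, ← inv_rpow_one_fourth_mul_self hη₀,
      ← mul_assoc]
    exact mul_le_mul_of_nonneg_right (hC η hη) hη₀.le
  have h_lim : Tendsto (fun η => C * (1 - P.M * η) ^ (3 / 4 : ℝ)) (𝓝[<] P.M⁻¹) (𝓝 0) := by
    have := (P.tendsto_one_sub_mul.rpow_const (p := 3 / 4) (Or.inr (by norm_num))).const_mul C
    rwa [Real.zero_rpow (by norm_num), mul_zero] at this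
  exact tendsto_nhdsWithin_iff.2 ⟨tendsto_of_tendsto_of_tendsto_of_le_of_le' tendsto_const_nhds
    h_lim (h_pos.mono fun _ => le_of_lt) h_bound, h_pos⟩

/-- The contribution of the temperature to the vorticity at a boundary maximum. -/
def forcing (η : ℝ) : ℝ := P.M * A.g η + (1 - P.M * η) * A.k η

theorem forcing_nonneg (hη : η ∈ Ico 0 P.M⁻¹) : 0 ≤ A.forcing η :=
  have hη' := P.Ico_subset_domain hη
  add_nonneg (mul_nonneg P.M_pos.le (A.g_nonneg η hη'))
    (mul_nonneg (P.one_sub_mul_pos hη.2).le (A.k_nonneg η hη' hη.1))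

theorem dx_dx_velocity_boundary (c : A.Clock) {t : ℝ} (ht : t ∈ Ioo c.start c.finish)
    (hx : x ∈ Icc (0 : ℝ) 1) (hx' : x = 0 ∨ x = 1) (hmax : P.h x = P.M) :
    dx (dx ((A.lagrangianFlow c).velocity t)) x =
      (P.h' x - P.r' x * A.forcing (c.η t)) * (A.invJac (c.η t) x)⁻¹ := by
  have hη := c.η_mem t ht
  have meanInv_ne := (A.meanInv_pos hη).ne'
  have hη₀ := (P.one_sub_mul_pos hη.2).ne'
  rw [(A.lagrangianFlow c).dx_dx_velocity ht hx, LagrangianFlow.strainGrad,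
    (A.lagrangianFlow c).labelMap_boundary ht hx']
  change A.invJacRate _ x * A.invJacGrad _ x / A.invJac _ x - A.invJacRateGrad _ x = _
  rw [A.invJac_boundary hx' hmax]
  simp only [invJacRate, invJacGrad, invJacRateGrad, denom, Profile.denom, denomDeriv, denomGrad,
    denomDerivGrad, forcing, hmax, P.r_eq_zero hx', zero_mul, add_zero]
  field_simp
  ring

variable (c : A.Clock)

theorem eventually_forcing_nonneg : ∀ᶠ t in 𝓝[<] c.finish, 0 ≤ A.forcing (c.η t) := by
  filter_upwards [Ioo_mem_nhdsLT c.finish_pos] with t ht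
  exact A.forcing_nonneg ⟨c.η_nonneg t (Ioo_subset_Ico_self ht),
    (c.η_mem t ⟨c.start_neg.trans ht.1, ht.2⟩).2⟩

theorem tendsto_integral_dx_velocity (hP : P.Nondegenerate) (hx : x ∈ Icc (0 : ℝ) 1)
    (hmax : P.h x = P.M) :
    Tendsto (fun t => ∫ s in (0 : ℝ)..t, dx ((A.lagrangianFlow c).velocity s) x) (𝓝[<] c.finish)
      atTop := by
  have h_log : Tendsto (fun t => -Real.log (A.invJac (c.η t) x)) (𝓝[<] c.finish) atTop :=
    tendsto_neg_atBot_atTop.comp (Real.tendsto_log_nhdsGT_zero.comp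
      ((A.tendsto_invJac_boundary hP hx hmax).comp c.tendsto_η))
  refine h_log.congr' ?_
  filter_upwards [Ioo_mem_nhdsLT c.finish_pos] with t ht
  exact ((A.lagrangianFlow c).integral_dx_boundary (Ioo_subset_Ico_self ht)
    (hP.eq_zero_or_one hx hmax)).symm

theorem eventually_dx_dx_velocity_eq (hP : P.Nondegenerate) (hx : x ∈ Icc (0 : ℝ) 1)
    (hmax : P.h x = P.M) : ∀ᶠ t in 𝓝[<] c.finish,
      (P.h' x - P.r' x * A.forcing (c.η t)) * (A.invJac (c.η t) x)⁻¹ =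
        dx (dx ((A.lagrangianFlow c).velocity t)) x := by
  filter_upwards [Ioo_mem_nhdsLT c.finish_pos] with t ht
  exact (A.dx_dx_velocity_boundary c ⟨c.start_neg.trans ht.1, ht.2⟩ hx
    (hP.eq_zero_or_one hx hmax) hmax).symm

theorem tendsto_dx_dx_velocity_zero (hP : P.Nondegenerate) (hmax : P.h 0 = P.M) :
    Tendsto (fun t => dx (dx ((A.lagrangianFlow c).velocity t)) 0) (𝓝[<] c.finish) atBot := by
  have h0 : (0 : ℝ) ∈ Icc (0 : ℝ) 1 := left_mem_Icc.2 zero_le_one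
  have h1 : (1 : ℝ) ∈ Icc (0 : ℝ) 1 := right_mem_Icc.2 zero_le_one
  have h'_nonpos : P.h' 0 ≤ 0 := by simpa using P.h'_mul_sub_nonpos h0 h1 hmax
  have r'_nonneg : 0 ≤ P.r' 0 := by simpa using P.r'_mul_sub_nonneg h0 h1 P.r_zero
  refine (tendsto_mul_inv_atBot (h'_nonpos.lt_of_ne (hP 0 h0 hmax))
    ((A.tendsto_invJac_boundary hP h0 hmax).comp c.tendsto_η) ?_).congr'
    (A.eventually_dx_dx_velocity_eq c hP h0 hmax)
  filter_upwards [A.eventually_forcing_nonneg c] with t ht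
  exact sub_le_self _ (mul_nonneg r'_nonneg ht)

theorem tendsto_dx_dx_velocity_one (hP : P.Nondegenerate) (hmax : P.h 1 = P.M) :
    Tendsto (fun t => dx (dx ((A.lagrangianFlow c).velocity t)) 1) (𝓝[<] c.finish) atTop := by
  have h0 : (0 : ℝ) ∈ Icc (0 : ℝ) 1 := left_mem_Icc.2 zero_le_one
  have h1 : (1 : ℝ) ∈ Icc (0 : ℝ) 1 := right_mem_Icc.2 zero_le_one
  have h'_nonneg : 0 ≤ P.h' 1 := by simpa using P.h'_mul_sub_nonpos h1 h0 hmax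
  have r'_nonpos : P.r' 1 ≤ 0 := by simpa using P.r'_mul_sub_nonneg h1 h0 P.r_one
  refine (tendsto_mul_inv_atTop (h'_nonneg.lt_of_ne' (hP 1 h1 hmax))
    ((A.tendsto_invJac_boundary hP h1 hmax).comp c.tendsto_η) ?_).congr'
    (A.eventually_dx_dx_velocity_eq c hP h1 hmax)
  filter_upwards [A.eventually_forcing_nonneg c] with t ht
  exact (le_sub_self_iff _).2 (mul_nonpos_of_nonpos_of_nonneg r'_nonpos ht)

theorem tendsto_abs_dx_dx_velocity (hP : P.Nondegenerate) (hx : x ∈ Icc (0 : ℝ) 1)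
    (hmax : P.h x = P.M) :
    Tendsto (fun t => |dx (dx ((A.lagrangianFlow c).velocity t)) x|) (𝓝[<] c.finish) atTop := by
  rcases hP.eq_zero_or_one hx hmax with rfl | rfl
  · exact tendsto_abs_atBot_atTop.comp (A.tendsto_dx_dx_velocity_zero c hP hmax)
  · exact tendsto_abs_atTop_atTop.comp (A.tendsto_dx_dx_velocity_one c hP hmax)

end Amplitude

theorem tendsto_abs_vorticity {f : ℝ → ℝ → ℝ} {x y : ℝ} {l : Filter ℝ} (hy : 0 < y)
    (h : Tendsto (fun t => |dx (dx (f t)) x|) l atTop) :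
    Tendsto (fun t => |vorticity f t x y|) l atTop := by
  simp only [vorticity, abs_mul, abs_neg, abs_of_pos hy]
  exact h.const_mul_atTop hy

theorem exists_dx_eq_zero {q : ℝ → ℝ} (hq : ContinuousOn q (Icc 0 1)) (h : q 0 = q 1) :
    ∃ x ∈ Ioo (0 : ℝ) 1, dx q x = 0 := by
  obtain ⟨x, hx, hqx⟩ := exists_deriv_eq_zero zero_lt_one hq h
  exact ⟨x, hx, (derivWithin_of_mem_nhds (Icc_mem_nhds hx.1 hx.2)).trans hqx⟩

theorem pos_of_isGreatest_dx {f₀ : ℝ → ℝ} {M₀ : ℝ} (hf₀ : ContDiffOn ℝ 2 f₀ (Icc 0 1))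
    (hf₀bc : f₀ 0 = f₀ 1) (hM₀ : IsGreatest (dx f₀ '' Icc 0 1) M₀)
    (hvort : ∀ x ∈ Icc (0 : ℝ) 1, dx f₀ x = M₀ → dx (dx f₀) x ≠ 0) : 0 < M₀ := by
  have hmax : ∀ x ∈ Icc (0 : ℝ) 1, dx f₀ x ≤ M₀ := fun x hx => hM₀.2 (mem_image_of_mem _ hx)
  obtain ⟨x, hx, hdx⟩ := exists_dx_eq_zero hf₀.continuousOn hf₀bc
  have hxI := Ioo_subset_Icc_self hx
  refine (hdx.symm.trans_le (hmax x hxI)).lt_of_ne' fun hzero => ?_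
  have hxM : dx f₀ x = M₀ := hdx.trans hzero.symm
  rcases eq_zero_or_one_of_isMaxOn (hasDerivWithinAt_dx (contDiffOn_dx hf₀) hxI)
    (fun y hy => (hmax y hy).trans_eq hxM.symm) hxI (hvort x hxI hxM) with rfl | rfl
  exacts [lt_irrefl _ hx.1, lt_irrefl _ hx.2]

theorem exists_profile {f₀ ρ₀ : ℝ → ℝ} {M₀ : ℝ} (hf₀ : ContDiffOn ℝ 2 f₀ (Icc 0 1))
    (hρ₀ : ContDiffOn ℝ 1 ρ₀ (Icc 0 1)) (hf₀bc : f₀ 0 = 0 ∧ f₀ 1 = 0)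
    (hρ₀bc : ρ₀ 0 = 0 ∧ ρ₀ 1 = 0) (hρ₀nonneg : ∀ x ∈ Icc (0 : ℝ) 1, 0 ≤ ρ₀ x)
    (hM₀pos : 0 < M₀) (hmax : ∀ x ∈ Icc (0 : ℝ) 1, dx f₀ x ≤ M₀) :
    ∃ P : Profile, P.M = M₀ ∧ P.h' = dx (dx f₀) ∧ (∀ x ∈ Icc (0 : ℝ) 1, P.h x = dx f₀ x) ∧
      (∀ x ∈ Icc (0 : ℝ) 1, f₀ x = ∫ y in (0 : ℝ)..x, P.h y) ∧
      ∀ x ∈ Icc (0 : ℝ) 1, ρ₀ x = P.r x := by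
  have h0 : (0 : ℝ) ∈ Icc (0 : ℝ) 1 := left_mem_Icc.2 zero_le_one
  have h1 : (1 : ℝ) ∈ Icc (0 : ℝ) 1 := right_mem_Icc.2 zero_le_one
  have cont_dx : ContinuousOn (dx f₀) (Icc 0 1) := (contDiffOn_dx hf₀).continuousOn
  obtain ⟨B₁, hB₁⟩ := isCompact_Icc.exists_bound_of_continuousOn cont_dx
  obtain ⟨B₂, hB₂⟩ := isCompact_Icc.exists_bound_of_continuousOn hρ₀.continuousOn
  set h := IccExtend zero_le_one ((Icc (0 : ℝ) 1).domRestrict (dx f₀))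
  set r := IccExtend zero_le_one ((Icc (0 : ℝ) 1).domRestrict ρ₀)
  have h_eq : ∀ x ∈ Icc (0 : ℝ) 1, h x = dx f₀ x := fun x hx => IccExtend_of_mem _ _ hx
  have r_eq : ∀ x ∈ Icc (0 : ℝ) 1, r x = ρ₀ x := fun x hx => IccExtend_of_mem _ _ hx
  have integral_h : ∀ x ∈ Icc (0 : ℝ) 1, f₀ x = ∫ y in (0 : ℝ)..x, h y := fun x hx => by
    have integral_dx_eq := integral_dx (hf₀.of_le one_le_two) hx
    rw [hf₀bc.1, sub_zero] at integral_dx_eq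
    refine integral_dx_eq.symm.trans (intervalIntegral.integral_congr fun y hy => (h_eq y ?_).symm)
    rw [uIcc_of_le hx.1] at hy
    exact ⟨hy.1, hy.2.trans hx.2⟩
  let P : Profile :=
    { h := h
      h' := dx (dx f₀)
      r := r
      r' := dx ρ₀
      M := M₀
      H := max (max B₁ B₂) 1
      continuous_h := cont_dx.domRestrict.Icc_extend'
      continuous_r := hρ₀.continuousOn.domRestrict.Icc_extend'
      M_pos := hM₀pos
      H_pos := lt_max_of_lt_right one_pos
      h_le := fun x => hmax _ (Subtype.coe_prop _)
      abs_h_le := fun x => (hB₁ _ (Subtype.coe_prop _)).trans (by simp)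
      r_nonneg := fun x => hρ₀nonneg _ (Subtype.coe_prop _)
      r_le := fun x => (le_abs_self _).trans ((hB₂ _ (Subtype.coe_prop _)).trans (by simp))
      deriv_h := fun x hx => (hasDerivWithinAt_dx (contDiffOn_dx hf₀) hx).congr h_eq (h_eq x hx)
      continuousOn_h' := continuousOn_dx (contDiffOn_dx hf₀)
      deriv_r := fun x hx => (hasDerivWithinAt_dx hρ₀ hx).congr r_eq (r_eq x hx)
      continuousOn_r' := continuousOn_dx hρ₀
      r_zero := (r_eq 0 h0).trans hρ₀bc.1
      r_one := (r_eq 1 h1).trans hρ₀bc.2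
      integral_h := (integral_h 1 h1).symm.trans hf₀bc.2 }
  exact ⟨P, rfl, rfl, h_eq, integral_h, fun x hx => (r_eq x hx).symm⟩

end Boussinesq

end

open Boussinesq in
theorem corollary3p3_general (f₀ ρ₀ : ℝ → ℝ) (M₀ : ℝ)
    (hf₀ : ContDiffOn ℝ 2 f₀ (Icc 0 1))
    (hρ₀ : ContDiffOn ℝ 1 ρ₀ (Icc 0 1))
    (hf₀bc : f₀ 0 = 0 ∧ f₀ 1 = 0)
    (hρ₀bc : ρ₀ 0 = 0 ∧ ρ₀ 1 = 0)
    (hρ₀nonneg : ∀ x ∈ Icc (0 : ℝ) 1, 0 ≤ ρ₀ x)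
    (hM₀ : IsGreatest (dx f₀ '' Icc 0 1) M₀)
    (hvort : ∀ x ∈ Icc (0 : ℝ) 1, dx f₀ x = M₀ → dx (dx f₀) x ≠ 0) :
    ∃ tstar : ℝ, 0 < tstar ∧ ∃ f ρ : ℝ → ℝ → ℝ,
      IsClassicalSolution f₀ ρ₀ tstar f ρ ∧
      (∀ (T : ℝ) (g σ : ℝ → ℝ → ℝ), IsClassicalSolution f₀ ρ₀ T g σ →
        T ≤ tstar ∧ ∀ t ∈ Ico 0 T, ∀ x ∈ Icc (0 : ℝ) 1, g t x = f t x ∧ σ t x = ρ t x) ∧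
      (∀ x ∈ Icc (0 : ℝ) 1, dx f₀ x = M₀ →
        Tendsto (fun t => ∫ s in (0 : ℝ)..t, dx (f s) x) (𝓝[<] tstar) atTop ∧
        ∀ y : ℝ, 0 < y → Tendsto (fun t => |vorticity f t x y|) (𝓝[<] tstar) atTop) ∧
      (dx f₀ 0 = M₀ → Tendsto (fun t => dx (dx (f t)) 0) (𝓝[<] tstar) atBot) ∧
      (dx f₀ 1 = M₀ → Tendsto (fun t => dx (dx (f t)) 1) (𝓝[<] tstar) atTop) := by
  obtain ⟨P, rfl, hh', hh, hf₀_eq, hρ₀_eq⟩ := exists_profile hf₀ hρ₀ hf₀bc hρ₀bc hρ₀nonneg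
    (pos_of_isGreatest_dx hf₀ (hf₀bc.1.trans hf₀bc.2.symm) hM₀ hvort)
    fun x hx => hM₀.2 (mem_image_of_mem _ hx)
  have hP : P.Nondegenerate := fun x hx hmax => hh' ▸ hvort x hx ((hh x hx).symm.trans hmax)
  obtain ⟨A⟩ := P.exists_amplitude
  obtain ⟨c⟩ := A.nonempty_clock hP
  have sol := (A.lagrangianFlow c).isClassicalSolution hf₀_eq hρ₀_eq
  refine ⟨c.finish, c.finish_pos, _, _, sol, fun T g σ hT => ?_, fun x hx hmax => ?_,
    fun hmax => A.tendsto_dx_dx_velocity_zero c hP ((hh 0 (by simp)).trans hmax),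
    fun hmax => A.tendsto_dx_dx_velocity_one c hP ((hh 1 (by simp)).trans hmax)⟩
  · obtain ⟨x, hx, hmax⟩ := hM₀.1
    have lifespan_le := sol.lifespan_le hT c.finish_pos hx
      (A.tendsto_integral_dx_velocity c hP hx ((hh x hx).trans hmax))
    exact ⟨lifespan_le, fun t ht y hy => hT.unique (sol.mono lifespan_le) ht hy⟩
  · have hmax' := (hh x hx).trans hmax
    exact ⟨A.tendsto_integral_dx_velocity c hP hx hmax', fun y hy =>
      tendsto_abs_vorticity hy (A.tendsto_abs_dx_dx_velocity c hP hx hmax')⟩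

theorem corollary3p3 (f₀ ρ₀ : ℝ → ℝ) (M₀ : ℝ)
    (hf₀ : ContDiffOn ℝ (⊤ : ℕ∞) f₀ (Icc 0 1))
    (hρ₀ : ContDiffOn ℝ (⊤ : ℕ∞) ρ₀ (Icc 0 1))
    (hf₀bc : f₀ 0 = 0 ∧ f₀ 1 = 0)
    (hρ₀bc : ρ₀ 0 = 0 ∧ ρ₀ 1 = 0)
    (hρ₀nonneg : ∀ x ∈ Icc (0 : ℝ) 1, 0 ≤ ρ₀ x)
    (hM₀ : IsGreatest (Boussinesq.dx f₀ '' Icc 0 1) M₀)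
    (hM₀pos : 0 < M₀)
    (hbdry : ∀ x ∈ Icc (0 : ℝ) 1, Boussinesq.dx f₀ x = M₀ → x = 0 ∨ x = 1)
    (hvort : ∀ x ∈ Icc (0 : ℝ) 1, Boussinesq.dx f₀ x = M₀ →
      Boussinesq.dx (Boussinesq.dx f₀) x ≠ 0) :
    ∃ tstar : ℝ, 0 < tstar ∧ ∃ f ρ : ℝ → ℝ → ℝ,
      -- a classical solution on `[0, tstar)`, unique and with maximal lifespan
      Boussinesq.IsClassicalSolution f₀ ρ₀ tstar f ρ ∧
      (∀ (T : ℝ) (g σ : ℝ → ℝ → ℝ), Boussinesq.IsClassicalSolution f₀ ρ₀ T g σ →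
        T ≤ tstar ∧ ∀ t ∈ Ico 0 T, ∀ x ∈ Icc (0 : ℝ) 1, g t x = f t x ∧ σ t x = ρ t x) ∧
      -- blowup at each boundary point where `f₀'` attains its maximum
      (∀ x ∈ Icc (0 : ℝ) 1, Boussinesq.dx f₀ x = M₀ →
        Tendsto (fun t => ∫ s in (0 : ℝ)..t, Boussinesq.dx (f s) x) (𝓝[<] tstar) atTop ∧
        ∀ y : ℝ, 0 < y →
          Tendsto (fun t => |Boussinesq.vorticity f t x y|) (𝓝[<] tstar) atTop) ∧
      -- two-sided blowup when the maximum is attained at both endpoints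
      (Boussinesq.dx f₀ 0 = M₀ → Boussinesq.dx f₀ 1 = M₀ →
        Tendsto (fun t => Boussinesq.dx (Boussinesq.dx (f t)) 0) (𝓝[<] tstar) atBot ∧
        Tendsto (fun t => Boussinesq.dx (Boussinesq.dx (f t)) 1) (𝓝[<] tstar) atTop) := by
  obtain ⟨tstar, htstar, f, ρ, sol, maximal, blowup, hzero, hone⟩ := corollary3p3_general f₀ ρ₀ M₀
    (hf₀.of_le (WithTop.coe_le_coe.2 le_top)) (hρ₀.of_le (by simp)) hf₀bc hρ₀bc hρ₀nonneg hM₀ hvort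
  exact ⟨tstar, htstar, f, ρ, sol, maximal, blowup, fun h₀ h₁ => ⟨hzero h₀, hone h₁⟩⟩
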